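/- Let $\beta\in\{1,2,4\}$, $\mathbb K=\mathbb R,\mathbb C,\mathbb H$ respectively, and let $1\le k\le n$ be integers, with $k<n$ if $\beta=1$. Put $\mathrm U^{(\beta)}(n)=\mathrm{SO}(n),\ \mathrm U(n),\ \mathrm{USp}(2n)$ for $\beta=1,2,4$ (the last being the group of quaternionic $n\times n$ matrices $A$ with $A^\dagger A=AA^\dagger=1$). Identify $\mathbb K^n$ with $\mathbb R^{\beta n}$ by listing the $\beta$ real components in $\mathbb R^n$ one after the other (with respect to $1,i,j,k$ if $\mathbb K=\mathbb H$). Let $J^{(0)}=1_{\beta n}$, and, in $n\times n$ blocks, $$J^{(1)}=\begin{pmatrix}0&1\\-1&0\end{pmatrix}\ (\beta=2),\qquad J^{(1)}=\begin{pmatrix}0&1&0&0\\-1&0&0&0\\0&0&0&-1\\0&0&1&0\end{pmatrix},\quad J^{(2)}=\begin{pmatrix}0&0&1&0\\0&0&0&1\\-1&0&0&0\\0&-1&0&0\end{pmatrix},\quad J^{(3)}=J^{(1)}J^{(2)}\ (\beta=4).$$ For a continuous function $f$ on $\mathbb R^{\beta n\times k}$ let $\int_{\mathrm{St}^{(\beta)}(n,n-k)}f$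 be the normalized $\mathrm U^{(\beta)}(n)$-invariant integral of $f$ over $\mathrm{St}^{(\beta)}(n,n-k)=\mathrm U^{(\beta)}(n)/\mathrm U^{(\beta)}(n-k)$, embedded in $\mathbb R^{\beta n\times k}$ by sending the class of $A$ to the first $k$ columns of $A$. Let $\Psi_\nu(x)=\Gamma(\nu+1)J_\nu(x)/(x/2)^\nu$, $\Psi_\nu(0)=1$, where $J_\nu$ is the Bessel function of the first kind. For $1\le j\le k$ and $u=(u_1,\dots,u_{j-1})\in\mathbb R^{\beta n\times(j-1)}$ let $$q_u(y)=\|y\|^2-\sum_{i=1}^{j-1}\sum_{l=0}^{\beta-1}\langle u_i,J^{(l)}y\rangle^2\qquad(y\in\mathbb R^{\beta n}),$$ which is the Fourier symbol of the operator $\sum_{i<j}\sum_l\langle u_i,J^{(l)}\nabla_{u_j}\rangle^2-\Delta_{u_j}$, and let $D_{j-1}$ be the set of all $u$ with $q_u(y)\ge0$ for all $y$, that is, for which this operator is nonnegative. For a Schwartz function $f\in\mathcal S(\mathbb R^{\beta n\times j})$ and $u\in D_{j-1}$ define $$T_{n,j}[f](u)=\Big(\Psi_{\beta(n-j+1)/2-1}\Big(\sqrt{\textstyle\sum_{i<j}\sum_{l}\langle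 u_i,J^{(l)}\nabla_{u_j}\rangle^2-\Delta_{u_j}}\Big)f\Big)(u_1,\dots,u_{j-1},0):=\int_{\mathbb R^{\beta n}}\Psi_{\beta(n-j+1)/2-1}\big(\sqrt{q_u(y)}\big)\,\widehat f(u,y)\,dy,$$ where $\widehat f(u,y)=(2\pi)^{-\beta n}\int_{\mathbb R^{\beta n}}e^{i\langle y,x\rangle}f(u_1,\dots,u_{j-1},x)\,dx$. Then: 1. For all $1\le j\le k$, $f\in\mathcal S(\mathbb R^{\beta n\times j})$ and $u\in D_{j-1}$ the integral over $y$ that defines $T_{n,j}[f](u)$ converges absolutely, and $T_{n,j}[f]$ is the restriction to $D_{j-1}$ of a Schwartz function on $\mathbb R^{\beta n\times(j-1)}$. 2. For every $f\in\mathcal S(\mathbb R^{\beta n\times k})$ the composition $T_{n,1}\circ T_{n,2}\circ\cdots\circ T_{n,k}[f]$ is a well-defined number and $$\int_{\mathrm{St}^{(\beta)}(n,n-k)}f=T_{n,1}\circ T_{n,2}\circ\cdots\circ T_{n,k}[f].$$ Here the composition is understood as follows: there are Schwartz functions $f_k=f$, $f_{k-1},\dots,f_0$, with $f_j\in\mathcal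 S(\mathbb R^{\beta n\times j})$ and $f_{j-1}=T_{n,j}[f_j]$ on $D_{j-1}$ for $1\le j\le k$, and for every such choice the number $f_0$ is the same. -/

import Mathlib

noncomputable section

namespace StiefelPizzetti

/-! ### The groups `SO(n)`, `U(n)`, `USp(2n)` as compact topological groups -/

section Groups

variable (n : ℕ)

/-- The compact symplectic group `USp(2n)`, as the group of quaternionic `n × n` matrices `A`
with `A† A = A A† = 1`. -/
abbrev quaternionUnitaryGroup : Submonoid (Matrix (Fin n) (Fin n) (Quaternion ℝ)) :=
  unitary (Matrix (Fin n) (Fin n) (Quaternion ℝ))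

theorem isCompact_of_entries {K : Type*} [NormedRing K] [ProperSpace K]
    {S : Set (Matrix (Fin n) (Fin n) K)} (hS : IsClosed S)
    (hb : ∀ A ∈ S, ∀ i j, ‖A i j‖ ≤ 1) : IsCompact S := by
  have h : IsCompact (Set.univ.pi fun _ : Fin n => Set.univ.pi fun _ : Fin n =>
      Metric.closedBall (0 : K) 1) :=
    isCompact_univ_pi fun _ => isCompact_univ_pi fun _ => isCompact_closedBall _ _
  refine IsCompact.of_isClosed_subset h hS ?_
  intro A hA i _ j _
  simpa using hb A hA i j

instance compactSpace_unitaryGroup : CompactSpace (Matrix.unitaryGroup (Fin n) ℂ) :=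
  isCompact_iff_compactSpace.mp
    (isCompact_of_entries n isClosed_unitary fun _ hA i j => entry_norm_bound_of_unitary hA i j)

theorem quaternion_entry_norm_le {A : Matrix (Fin n) (Fin n) (Quaternion ℝ)}
    (hA : A ∈ quaternionUnitaryGroup n) (i j : Fin n) : ‖A i j‖ ≤ 1 := by
  have h1 : (star A * A) j j = 1 := by
    rw [(Unitary.mem_iff.mp hA).1, Matrix.one_apply_eq]
  rw [Matrix.mul_apply] at h1
  have h2 : ∑ x, ‖A x j‖ ^ 2 = 1 := by
    have h3 : ((∑ x, ‖A x j‖ ^ 2 : ℝ) : Quaternion ℝ) = ((1 : ℝ) : Quaternion ℝ) := by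
      rw [Quaternion.coe_one, ← h1, ← Quaternion.algebraMap_def, map_sum]
      refine Finset.sum_congr rfl fun x _ => ?_
      rw [Matrix.star_apply, Quaternion.star_mul_self, Quaternion.normSq_eq_norm_mul_self,
        Quaternion.algebraMap_def, sq]
    exact Quaternion.coe_injective h3
  have h4 : ‖A i j‖ ^ 2 ≤ 1 := by
    rw [← h2]
    exact Finset.single_le_sum (f := fun x => ‖A x j‖ ^ 2) (fun x _ => sq_nonneg _)
      (Finset.mem_univ i)
  nlinarith [norm_nonneg (A i j)]

instance compactSpace_quaternionUnitaryGroup : CompactSpace (quaternionUnitaryGroup n) :=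
  haveI : ProperSpace (Quaternion ℝ) := FiniteDimensional.proper ℝ _
  isCompact_iff_compactSpace.mp
    (isCompact_of_entries n isClosed_unitary fun _ hA i j => quaternion_entry_norm_le n hA i j)

instance compactSpace_specialOrthogonalGroup :
    CompactSpace (Matrix.specialOrthogonalGroup (Fin n) ℝ) := by
  refine isCompact_iff_compactSpace.mp (isCompact_of_entries n ?_ ?_)
  · have h : ((Matrix.specialOrthogonalGroup (Fin n) ℝ : Submonoid _) :
        Set (Matrix (Fin n) (Fin n) ℝ)) =
        (unitary (Matrix (Fin n) (Fin n) ℝ) : Set _) ∩ {A | A.det = 1} := by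
      ext A
      exact Matrix.mem_specialOrthogonalGroup_iff
    rw [h]
    exact isClosed_unitary.inter
      (isClosed_eq (Continuous.matrix_det continuous_id) continuous_const)
  · intro A hA i j
    exact entry_norm_bound_of_unitary (Matrix.mem_specialOrthogonalGroup_iff.mp hA).1 i j

instance isTopologicalGroup_specialOrthogonalGroup :
    IsTopologicalGroup (Matrix.specialOrthogonalGroup (Fin n) ℝ) where
  continuous_inv := by
    refine Continuous.subtype_mk (f := fun A : Matrix.specialOrthogonalGroup (Fin n) ℝ =>
      star (A : Matrix (Fin n) (Fin n) ℝ)) ?_ _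
    exact continuous_subtype_val.star

end Groups

/-- The average of `φ` over a compact group with respect to the Haar probability measure. -/
def haarAverage (G : Type*) [Group G] [TopologicalSpace G] [IsTopologicalGroup G]
    [CompactSpace G] (φ : G → ℂ) : ℂ :=
  letI : MeasurableSpace G := borel G
  haveI : BorelSpace G := ⟨rfl⟩
  ∫ g, φ g ∂(MeasureTheory.Measure.haarMeasure (⊤ : TopologicalSpace.PositiveCompacts G))

/-! ### The real vector space `ℝ^{βn}` and the matrices `J^{(l)}` -/

/-- The three cases `β = 1` (real), `β = 2` (complex), `β = 4` (quaternion). -/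
inductive Dyson
  | real
  | complex
  | quaternion

/-- The Dyson index `β ∈ {1, 2, 4}`. -/
def Dyson.beta : Dyson → ℕ
  | .real => 1
  | .complex => 2
  | .quaternion => 4

/-- `ℝ^{βn}` with its Euclidean structure: `β` blocks of length `n`, so that `u (a, i)` is the
`i`-th entry of the `a`-th real component `u^{(a+1)} ∈ ℝⁿ`. -/
abbrev Vec (b : Dyson) (n : ℕ) : Type := EuclideanSpace ℝ (Fin b.beta × Fin n)

/-- The `β × β` pattern of `J^{(l)}`, `l = 0, …, β - 1`. -/
def jBlock : (b : Dyson) → Fin b.beta → Matrix (Fin b.beta) (Fin b.beta) ℝ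
  | .real => fun _ => (!![1] : Matrix (Fin 1) (Fin 1) ℝ)
  | .complex => (![1, !![0, 1; -1, 0]] : Fin 2 → Matrix (Fin 2) (Fin 2) ℝ)
  | .quaternion =>
      (![1,
        !![0, 1, 0, 0; -1, 0, 0, 0; 0, 0, 0, -1; 0, 0, 1, 0],
        !![0, 0, 1, 0; 0, 0, 0, 1; -1, 0, 0, 0; 0, -1, 0, 0],
        !![0, 0, 0, 1; 0, 0, -1, 0; 0, 1, 0, 0; -1, 0, 0, 0]] :
        Fin 4 → Matrix (Fin 4) (Fin 4) ℝ)

/-- The `βn × βn` matrix `J^{(l)}`: every entry of `jBlock b l` is multiplied by the `n × n`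
identity matrix. -/
def jMat (b : Dyson) (n : ℕ) (l : Fin b.beta) :
    Matrix (Fin b.beta × Fin n) (Fin b.beta × Fin n) ℝ :=
  Matrix.kroneckerMap (fun x y => x * y) (jBlock b l) 1

/-! ### Integration over the Stiefel manifold -/

/-- The first `k` columns of a real matrix, as vectors of `ℝⁿ`. -/
def realColumns {n k : ℕ} (hk : k ≤ n) (A : Matrix (Fin n) (Fin n) ℝ) :
    Fin k → Vec .real n :=
  fun j => WithLp.toLp 2 fun p => A p.2 (Fin.castLE hk j)

/-- The first `k` columns of a complex matrix, as vectors of `ℂⁿ ≅ ℝ^{2n}` (real parts, then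
imaginary parts). -/
def complexColumns {n k : ℕ} (hk : k ≤ n) (A : Matrix (Fin n) (Fin n) ℂ) :
    Fin k → Vec .complex n :=
  fun j => WithLp.toLp 2 fun p =>
    (![(A p.2 (Fin.castLE hk j)).re, (A p.2 (Fin.castLE hk j)).im] : Fin 2 → ℝ) p.1

/-- The first `k` columns of a quaternionic matrix, as vectors of `ℍⁿ ≅ ℝ^{4n}` (the blocks are
the components with respect to `1, i, j, k`). -/
def quaternionColumns {n k : ℕ} (hk : k ≤ n) (A : Matrix (Fin n) (Fin n) (Quaternion ℝ)) :
    Fin k → Vec .quaternion n :=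
  fun j => WithLp.toLp 2 fun p =>
    (![(A p.2 (Fin.castLE hk j)).re, (A p.2 (Fin.castLE hk j)).imI,
      (A p.2 (Fin.castLE hk j)).imJ, (A p.2 (Fin.castLE hk j)).imK] : Fin 4 → ℝ) p.1

/-- The normalized `U^{(β)}(n)`-invariant integral of `f` over the Stiefel manifold
`St^{(β)}(n, n-k) = U^{(β)}(n) / U^{(β)}(n-k)`. The coset of `A` is embedded in `ℝ^{βn × k}` as the
tuple of the first `k` columns of `A`, and the invariant measure is the image of the Haar
probability measure of `U^{(β)}(n)`. -/
def stiefelIntegral : (b : Dyson) → {n k : ℕ} → k ≤ n → ((Fin k → Vec b n) → ℂ) → ℂ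
  | .real, n, _, hk, f =>
      haarAverage (Matrix.specialOrthogonalGroup (Fin n) ℝ) fun A => f (realColumns hk A)
  | .complex, n, _, hk, f =>
      haarAverage (Matrix.unitaryGroup (Fin n) ℂ) fun A => f (complexColumns hk A)
  | .quaternion, n, _, hk, f =>
      haarAverage (quaternionUnitaryGroup n) fun A => f (quaternionColumns hk A)

/-! ### Bessel functions -/

/-- The Bessel function of the first kind `J_ν`, for `x > 0`. -/
def besselJ (ν x : ℝ) : ℝ :=
  ∑' m : ℕ, (-1) ^ m / (m.factorial * Real.Gamma (m + ν + 1)) * (x / 2) ^ (2 * (m : ℝ) + ν)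

/-- The renormalized Bessel function `Ψ_ν(x) = Γ(ν + 1) J_ν(x) / (x/2)^ν`, `Ψ_ν(0) = 1`. -/
def besselPsi (ν x : ℝ) : ℝ :=
  if x = 0 then 1 else Real.Gamma (ν + 1) * besselJ ν x / (x / 2) ^ ν

/-! ### The operators `T_{n,j}` -/

section Operators

variable {b : Dyson} {n : ℕ}

/-- The Fourier symbol `‖y‖² - ∑_i ∑_l ⟨u_i, J^{(l)} y⟩²` of the differential operator
`∑_i ∑_l ⟨u_i, J^{(l)} ∇⟩² - Δ` on `ℝ^{βn}`, i.e. the factor by which this operator multiplies the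
plane waves `x ↦ exp(∓ i ⟨y, x⟩)`. -/
def symbol {j : ℕ} (u : Fin j → Vec b n) (y : Vec b n) : ℝ :=
  ‖y‖ ^ 2 - ∑ i : Fin j, ∑ l : Fin b.beta,
    (inner ℝ (u i) (WithLp.toLp 2 ((jMat b n l).mulVec y.ofLp) : Vec b n)) ^ 2

/-- The tuples `u` for which the differential operator `∑_i ∑_l ⟨u_i, J^{(l)} ∇⟩² - Δ` is
nonnegative, so that its square root is defined. -/
def nonnegDomain (b : Dyson) (n j : ℕ) : Set (Fin j → Vec b n) :=
  {u | ∀ y : Vec b n, 0 ≤ symbol u y}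

/-- The Fourier transform `(2π)^{-βn} ∫ exp(i ⟨y, x⟩) g(x) dx`, whose inverse is
`h ↦ ∫ exp(-i ⟨y, x⟩) h(y) dy`. -/
def fourier (g : Vec b n → ℂ) (y : Vec b n) : ℂ :=
  (((2 * Real.pi) ^ (b.beta * n))⁻¹ : ℝ) *
    ∫ x : Vec b n, Complex.exp (Complex.I * (inner ℝ y x : ℝ)) * g x

/-- The Fourier transform of `Ψ_ν(√L_u) g`, where `L_u = ∑_i ∑_l ⟨u_i, J^{(l)} ∇⟩² - Δ`. -/
def besselMultiplier (ν : ℝ) {j : ℕ} (u : Fin j → Vec b n) (g : Vec b n → ℂ) (y : Vec b n) : ℂ :=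
  (besselPsi ν (Real.sqrt (symbol u y)) : ℝ) * fourier g y

/-- The function `Ψ_ν(√L_u) g`, where `L_u = ∑_i ∑_l ⟨u_i, J^{(l)} ∇⟩² - Δ` acts in the variable
of `g`; it is used for `u ∈ nonnegDomain b n j`. -/
def besselOperator (ν : ℝ) {j : ℕ} (u : Fin j → Vec b n) (g : Vec b n → ℂ) (x : Vec b n) : ℂ :=
  ∫ y : Vec b n, Complex.exp (-(Complex.I * (inner ℝ y x : ℝ))) * besselMultiplier ν u g y

/-- The index `β(n - j + 1)/2 - 1` of the Bessel function in `T_{n,j}`. -/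
def order (b : Dyson) (n j : ℕ) : ℝ := b.beta * ((n : ℝ) - j + 1) / 2 - 1

/-- `f` as a function of its last variable, the others being fixed to be `u`. -/
def lastSlice {j : ℕ} (f : (Fin (j + 1) → Vec b n) → ℂ) (u : Fin j → Vec b n) : Vec b n → ℂ :=
  fun x => f (Fin.snoc (α := fun _ => Vec b n) u x)

/-- The operator `T_{n,j+1}`: apply `Ψ_{β(n-j)/2-1}(√L_u)` in the last variable of `f` and evaluate
at `0` there. -/
def opT {j : ℕ} (f : (Fin (j + 1) → Vec b n) → ℂ) (u : Fin j → Vec b n) : ℂ :=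
  besselOperator (order b n (j + 1)) u (lastSlice f u) 0

/-- `IsIteratedT k f c` says that `c` is a value of `(T_{n,1} ∘ ⋯ ∘ T_{n,k})[f]`: there are Schwartz
functions `f_k = f, f_{k-1}, …, f_0` with `f_{j-1} = T_{n,j}[f_j]` on the set of all tuples where the
operator under the square root is nonnegative, and `c = f_0`. -/
def IsIteratedT : (k : ℕ) → SchwartzMap (Fin k → Vec b n) ℂ → ℂ → Prop
  | 0, f, c => c = f 0
  | k + 1, f, c => ∃ g : SchwartzMap (Fin k → Vec b n) ℂ,
      Set.EqOn g (opT f) (nonnegDomain b n k) ∧ IsIteratedT k g c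

end Operators

end StiefelPizzetti

end

open MeasureTheory SchwartzMap
open scoped FourierTransform LineDeriv ContDiff

namespace StiefelPizzetti

noncomputable section

/-! If `u` consists of the images under a group element `g` of the first `j` standard basis vectors,
its symbol at `y` is the squared norm of the projection of `y` onto the orthogonal complement of the
𝕂-span of `u` (`symbol_frame`). That complement has real dimension `d = β(n - j)`, and
`Ψ_{d/2-1}(|·|)` is the Fourier transform of the uniform probability measure on its unit sphere
(`integral_exp_inner_eq`). By Fubini and Fourier inversion, `opT f u` is therefore the mean of `f
(u, x)` over this sphere. As the stabilizer of the first `j` basis vectors acts transitively there,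
this is a mean of `f` on the frames of `g * h` over `h` in the stabilizer (`opT_frame`). Integration
over `g` and right invariance of Haar measure absorb `h` (`integral_opT_frame`), and induction on
`j` gives the Stiefel integral. Only values on frames enter, and frames lie in `nonnegDomain`, so
the choice of Schwartz extensions is immaterial.

Existence of the extensions is a separate, analytic matter. The function `z ↦ Ψ_ν(√z)` is entire,
its derivatives are multiples of the same functions at `ν + r`, and these are bounded on `[0, ∞)`
because they are characteristic functions of spheres in dimension `d + 2r`. Cut off for negative
`z`, it becomes a multiplier of temperate growth, defined for all `u`. The resulting integral is
smooth in `u` (`contDiff_integral_fourier_slice`), and since `nonnegDomain` is bounded, a bump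
function makes it Schwartz (`exists_schwartz_eqOn_besselOperator`). -/

theorem hasTemperateGrowth_clm_comp {D A B : Type*} [NormedAddCommGroup D] [NormedSpace ℝ D]
    [NormedAddCommGroup A] [NormedSpace ℝ A] [NormedAddCommGroup B] [NormedSpace ℝ B]
    (L : A →L[ℝ] B) {g : D → A} (hg : g.HasTemperateGrowth) :
    Function.HasTemperateGrowth fun z => L (g z) :=
  L.hasTemperateGrowth.comp hg

/-! ### Partial Fourier transforms of Schwartz functions, smooth in the parameter. -/

section Slices

variable {U V : Type} [NormedAddCommGroup U] [NormedSpace ℝ U]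
  [NormedAddCommGroup V] [InnerProductSpace ℝ V]

theorem hasTemperateGrowth_prodMk (u : U) :
    Function.HasTemperateGrowth (fun x : V => (u, x)) := by
  have h : (fun x : V => (u, x)) = fun x => (u, (0 : V)) + ContinuousLinearMap.inr ℝ U V x := by
    ext x <;> simp
  rw [h]
  exact (Function.HasTemperateGrowth.const _).add
    (ContinuousLinearMap.inr ℝ U V).hasTemperateGrowth

omit [NormedSpace ℝ U] [InnerProductSpace ℝ V] in
theorem antilipschitz_prodMk (u : U) : AntilipschitzWith 1 (fun x : V => (u, x)) := by
  refine AntilipschitzWith.of_le_mul_dist fun x y => ?_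
  simp [Prod.dist_eq]

/-- The restriction of a Schwartz function on `U × V` to `{u} × V`. -/
def slice (f : 𝓢(U × V, ℂ)) (u : U) : 𝓢(V, ℂ) :=
  compCLMOfAntilipschitz ℝ (hasTemperateGrowth_prodMk u) (antilipschitz_prodMk u) f

@[simp] theorem slice_apply (f : 𝓢(U × V, ℂ)) (u : U) (x : V) : slice f u x = f (u, x) := rfl

/-- The slice is `f` composed with an affine map whose linear part `inr` has norm at most one, and
`‖x‖ ≤ ‖(u, x)‖`. The bound is uniform in `u`, as domination under the integral requires. -/
theorem seminorm_slice_le (f : 𝓢(U × V, ℂ)) (u : U) (k n : ℕ) :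
    SchwartzMap.seminorm ℂ k n (slice f u) ≤ SchwartzMap.seminorm ℂ k n f := by
  refine seminorm_le_bound ℂ k n _ (apply_nonneg _ _) fun x => ?_
  have h : (slice f u : V → ℂ) =
      (fun z : U × V => f ((u, 0) + z)) ∘ ContinuousLinearMap.inr ℝ U V := by
    ext x; simp
  have h1 : ‖iteratedFDeriv ℝ n (slice f u) x‖ ≤ ‖iteratedFDeriv ℝ n f (u, x)‖ := by
    have hc : ContDiff ℝ n (fun z : U × V => f ((u, 0) + z)) :=
      (f.smooth n).comp (contDiff_const.add contDiff_id)
    rw [h, ContinuousLinearMap.iteratedFDeriv_comp_right _ hc _ le_rfl,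
      iteratedFDeriv_comp_add_left]
    refine (ContinuousMultilinearMap.norm_compContinuousLinearMap_le _ _).trans ?_
    simp only [Finset.prod_const, ContinuousLinearMap.inr_apply, Prod.mk_add_mk, add_zero, zero_add]
    exact mul_le_of_le_one_right (norm_nonneg _)
      (pow_le_one₀ (norm_nonneg _) (ContinuousLinearMap.norm_inr_le_one ℝ U V))
  have h2 : ‖x‖ ≤ ‖(u, x)‖ := le_max_right _ _
  calc ‖x‖ ^ k * ‖iteratedFDeriv ℝ n (slice f u) x‖
      ≤ ‖(u, x)‖ ^ k * ‖iteratedFDeriv ℝ n f (u, x)‖ := by gcongr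
    _ ≤ _ := le_seminorm ℂ k n f (u, x)

theorem exists_forall_slice_bound [FiniteDimensional ℝ V] (f : 𝓢(U × V, ℂ)) (k : ℕ) :
    ∃ C, 0 ≤ C ∧ ∀ u x, (1 + ‖x‖) ^ k * ‖f (u, x)‖ ≤ C := by
  refine ⟨_, mul_nonneg (by positivity) (apply_nonneg _ _), fun u x => le_trans ?_
    (one_add_le_sup_seminorm_apply (𝕜 := ℂ) (m := (k, 0)) le_rfl le_rfl f (u, x))⟩
  rw [norm_iteratedFDeriv_zero]
  have h2 : ‖x‖ ≤ ‖(u, x)‖ := le_max_right _ _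
  gcongr

variable [FiniteDimensional ℝ V] [MeasurableSpace V] [BorelSpace V]

/-- Continuity of the Fourier transform on Schwartz space bounds each seminorm of the transform by
finitely many seminorms of the slice, and those are controlled by `f` alone. -/
theorem exists_forall_fourier_slice_bound (f : 𝓢(U × V, ℂ)) (k : ℕ) :
    ∃ C, 0 ≤ C ∧ ∀ u y, (1 + ‖y‖) ^ k * ‖𝓕 (slice f u) y‖ ≤ C := by
  have key : ∀ m : ℕ × ℕ, ∃ C, 0 ≤ C ∧ ∀ u, SchwartzMap.seminorm ℂ m.1 m.2 (𝓕 (slice f u)) ≤ C := by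
    intro m
    obtain ⟨s, C, hC, h⟩ := Seminorm.bound_of_continuous (schwartz_withSeminorms ℂ V ℂ)
      ((schwartzSeminormFamily ℂ V ℂ m).comp (fourierTransformCLM ℂ (V := V) (E := ℂ)).toLinearMap)
      (((schwartz_withSeminorms ℂ V ℂ).continuous_seminorm m).comp
        (fourierTransformCLM ℂ (V := V) (E := ℂ)).continuous)
    refine ⟨C * (s.sup (schwartzSeminormFamily ℂ (U × V) ℂ)) f, by positivity, fun u => ?_⟩
    refine (h (slice f u)).trans ?_
    rw [_root_.smul_apply, NNReal.smul_def, smul_eq_mul]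
    gcongr
    refine Seminorm.finset_sup_apply_le (apply_nonneg _ _) fun i hi => ?_
    exact (seminorm_slice_le f u i.1 i.2).trans
      (Seminorm.le_finset_sup_apply (p := schwartzSeminormFamily ℂ (U × V) ℂ) hi)
  choose C hC0 hC using key
  refine ⟨2 ^ k * ∑ i ∈ Finset.Iic (k, 0), C i, ?_, fun u y => ?_⟩
  · exact mul_nonneg (by positivity) (Finset.sum_nonneg fun i _ => hC0 i)
  · have h := one_add_le_sup_seminorm_apply (𝕜 := ℂ) (m := (k, 0)) le_rfl le_rfl (𝓕 (slice f u)) y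
    rw [norm_iteratedFDeriv_zero] at h
    refine h.trans ?_
    gcongr
    refine Seminorm.finset_sup_apply_le (Finset.sum_nonneg fun i _ => hC0 i) fun i hi => ?_
    exact (hC i u).trans (Finset.single_le_sum (fun i _ => hC0 i) hi)

theorem integrable_of_one_add_norm_pow_bound {F : Type*} [NormedAddCommGroup F] {g : V → F} {C : ℝ}
    (hg : AEStronglyMeasurable g volume)
    (h : ∀ x, (1 + ‖x‖) ^ (Module.finrank ℝ V + 1) * ‖g x‖ ≤ C) : Integrable g := by
  have hi : Integrable (fun x : V => C * (1 + ‖x‖) ^ (-((Module.finrank ℝ V + 1 : ℕ) : ℝ))) :=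
    (integrable_one_add_norm (by norm_num)).const_mul C
  refine hi.mono' hg (Filter.Eventually.of_forall fun x => ?_)
  rw [Real.rpow_neg (by positivity), Real.rpow_natCast, ← div_eq_mul_inv,
    le_div_iff₀ (by positivity), mul_comm]
  exact h x

theorem fourier_slice_eq (f : 𝓢(U × V, ℂ)) (u : U) (y : V) :
    𝓕 (slice f u) y = ∫ x : V, (Real.fourierChar (-inner ℝ x y) : ℂ) * f (u, x) := by
  rw [SchwartzMap.fourier_coe, Real.fourier_eq]
  rfl

variable [FiniteDimensional ℝ U]

/-- The `i`-th coordinate functional of a basis, as a continuous linear functional. -/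
def coordCLM {ι : Type} (B : Module.Basis ι ℝ U) (i : ι) : U →L[ℝ] ℝ :=
  LinearMap.toContinuousLinearMap (B.coord i)

/-- Differentiation under the integral. The derivative is expanded in a basis of `U` so that its
coefficients are again Fourier transforms of slices of Schwartz functions. -/
theorem hasFDerivAt_fourier_slice {ι : Type} [Fintype ι] (B : Module.Basis ι ℝ U)
    (f : 𝓢(U × V, ℂ)) (u : U) (y : V) :
    HasFDerivAt (fun u => 𝓕 (slice f u) y)
      (∑ i, (coordCLM B i).smulRight (𝓕 (slice (∂_{(B i, (0 : V))} f) u) y)) u := by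
  simp only [fourier_slice_eq]
  set e : V → ℂ := fun x => (Real.fourierChar (-inner ℝ x y) : ℂ) with he
  have hec : Continuous e := by
    have : Continuous fun x : V => Real.fourierChar (-inner ℝ x y) :=
      Real.continuous_fourierChar.comp (by fun_prop)
    exact continuous_subtype_val.comp this
  have hen : ∀ x, ‖e x‖ = 1 := fun x => Circle.norm_coe _
  have hcont : ∀ (g : 𝓢(U × V, ℂ)) u, Continuous fun x => e x * g (u, x) := fun g u =>
    hec.mul (g.continuous.comp (by fun_prop))
  have hint : ∀ (g : 𝓢(U × V, ℂ)) u, Integrable fun x => e x * g (u, x) := by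
    intro g u
    obtain ⟨C, -, hC⟩ := exists_forall_slice_bound g (Module.finrank ℝ V + 1)
    refine integrable_of_one_add_norm_pow_bound (C := C) (hcont g u).aestronglyMeasurable fun x => ?_
    rw [norm_mul, hen, one_mul]; exact hC u x
  set F' : U → V → U →L[ℝ] ℂ := fun u x =>
    ∑ i, (coordCLM B i).smulRight (e x * (∂_{(B i, (0 : V))} f) (u, x)) with hF'
  have hI : ∫ x, F' u x =
      ∑ i, (coordCLM B i).smulRight (∫ x, e x * (∂_{(B i, (0 : V))} f) (u, x)) := by
    simp only [hF']
    refine (integral_finsetSum _ fun i _ => (ContinuousLinearMap.smulRightL ℝ U ℂ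
      (coordCLM B i)).integrable_comp (hint (∂_{(B i, (0 : V))} f) u)).trans ?_
    exact Finset.sum_congr rfl fun i _ =>
      (ContinuousLinearMap.smulRightL ℝ U ℂ (coordCLM B i)).integral_comp_comm (hint _ u)
  rw [← hI]
  obtain ⟨C, hC0, hC⟩ : ∃ C : ι → ℝ, (∀ i, 0 ≤ C i) ∧ ∀ i u x, (1 + ‖x‖) ^ (Module.finrank ℝ V + 1) *
      ‖(∂_{(B i, (0 : V))} f) (u, x)‖ ≤ C i := by
    choose C h0 h using fun i =>
      exists_forall_slice_bound (∂_{(B i, (0 : V))} f) (Module.finrank ℝ V + 1)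
    exact ⟨C, h0, h⟩
  refine hasFDerivAt_integral_of_dominated_of_fderiv_le (F := fun u x => e x * f (u, x))
    (s := Set.univ) (bound := fun x => (∑ i, ‖coordCLM B i‖ * C i) *
      (1 + ‖x‖) ^ (-((Module.finrank ℝ V + 1 : ℕ) : ℝ))) Filter.univ_mem
    (Filter.Eventually.of_forall fun u => (hcont f u).aestronglyMeasurable) (hint f u) ?_ ?_ ?_ ?_
  · refine Continuous.aestronglyMeasurable ?_
    exact continuous_finsetSum _ fun i _ =>
      (ContinuousLinearMap.smulRightL ℝ U ℂ (coordCLM B i)).continuous.comp (hcont _ u)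
  · refine Filter.Eventually.of_forall fun x u _ => ?_
    rw [Finset.sum_mul]
    refine (norm_sum_le _ _).trans (Finset.sum_le_sum fun i _ => ?_)
    rw [ContinuousLinearMap.norm_smulRight_apply, norm_mul, hen, one_mul, mul_assoc]
    gcongr
    rw [Real.rpow_neg (by positivity), Real.rpow_natCast, ← div_eq_mul_inv,
      le_div_iff₀ (by positivity), mul_comm]
    exact hC i u x
  · exact (integrable_one_add_norm (by norm_num)).const_mul _
  · refine Filter.Eventually.of_forall fun x u _ => ?_
    have h1 : HasFDerivAt (fun u => f (u, x))
        ((fderiv ℝ f (u, x)).comp (ContinuousLinearMap.inl ℝ U V)) u :=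
      (f.hasFDerivAt (u, x)).comp u (hasFDerivAt_prodMk_left u x)
    refine (h1.const_mul (e x)).congr_fderiv ?_
    ext v
    have hv : v = ∑ i, B.coord i v • B i := (B.sum_repr v).symm
    simp only [hF', _root_.sum_apply, ContinuousLinearMap.smulRight_apply,
      lineDerivOp_apply_eq_fderiv, _root_.smul_apply, ContinuousLinearMap.comp_apply,
      ContinuousLinearMap.inl_apply, smul_eq_mul]
    conv_lhs => rw [hv]
    have : ((∑ i, B.coord i v • B i, 0) : U × V) = ∑ i, B.coord i v • (B i, (0 : V)) := by
      ext <;> simp [Prod.fst_sum, Prod.snd_sum]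
    rw [this, map_sum, Finset.mul_sum]
    refine Finset.sum_congr rfl fun i _ => ?_
    rw [map_smul]
    simp only [coordCLM, LinearMap.coe_toContinuousLinearMap', Complex.real_smul]
    ring

omit [InnerProductSpace ℝ V] [FiniteDimensional ℝ V] [MeasurableSpace V] [BorelSpace V]
  [FiniteDimensional ℝ U] in
theorem hasTemperateGrowth_fderiv [NormedSpace ℝ V] {f : U → V} (hf : f.HasTemperateGrowth) :
    (fderiv ℝ f).HasTemperateGrowth := by
  refine ⟨hf.1.fderiv_right (by simp), fun n => ?_⟩
  obtain ⟨k, C, h⟩ := hf.2 (n + 1)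
  exact ⟨k, C, fun x => by rw [norm_iteratedFDeriv_fderiv]; exact h x⟩

omit [FiniteDimensional ℝ U] in
-- For `u` in a bounded set the multiplier grows only polynomially in `y`, and the rapid decay of
-- the Fourier transform absorbs this with enough powers to spare for integrability.
theorem exists_local_bound_multiplier {F : Type} [NormedAddCommGroup F] [NormedSpace ℝ F]
    {K : U × V → ℂ →L[ℝ] F} (hK : K.HasTemperateGrowth) (f : 𝓢(U × V, ℂ)) (u₀ : U) :
    ∃ C, ∀ u ∈ Metric.ball u₀ 1, ∀ y,
      (1 + ‖y‖) ^ (Module.finrank ℝ V + 1) * ‖K (u, y) (𝓕 (slice f u) y)‖ ≤ C := by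
  obtain ⟨k, C, hC0, hC⟩ := hK.norm_iteratedFDeriv_le_uniform 0
  obtain ⟨C', -, hC'⟩ := exists_forall_fourier_slice_bound f (k + (Module.finrank ℝ V + 1))
  refine ⟨C * (2 + ‖u₀‖) ^ k * C', fun u hu y => ?_⟩
  have h1 : ‖K (u, y)‖ ≤ C * (1 + ‖(u, y)‖) ^ k := by
    simpa using hC 0 le_rfl (u, y)
  have h2 : ‖u‖ ≤ 1 + ‖u₀‖ := by
    have := norm_le_norm_add_norm_sub u₀ u
    have h3 : ‖u - u₀‖ < 1 := by simpa [dist_eq_norm] using hu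
    rw [norm_sub_rev] at h3
    linarith [norm_sub_rev u u₀]
  have h3 : 1 + ‖(u, y)‖ ≤ (2 + ‖u₀‖) * (1 + ‖y‖) := by
    have : ‖(u, y)‖ ≤ ‖u‖ + ‖y‖ := max_le_add_of_nonneg (norm_nonneg _) (norm_nonneg _)
    nlinarith [norm_nonneg u₀, norm_nonneg y, mul_nonneg (norm_nonneg u₀) (norm_nonneg y)]
  calc (1 + ‖y‖) ^ (Module.finrank ℝ V + 1) * ‖K (u, y) (𝓕 (slice f u) y)‖
      ≤ (1 + ‖y‖) ^ (Module.finrank ℝ V + 1) *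
        ((C * ((2 + ‖u₀‖) * (1 + ‖y‖)) ^ k) * ‖𝓕 (slice f u) y‖) := by
        gcongr
        refine ((K (u, y)).le_opNorm _).trans ?_
        gcongr
        exact h1.trans (by gcongr)
    _ = C * (2 + ‖u₀‖) ^ k *
        ((1 + ‖y‖) ^ (k + (Module.finrank ℝ V + 1)) * ‖𝓕 (slice f u) y‖) := by rw [mul_pow]; ring
    _ ≤ _ := by gcongr; exact hC' u y

omit [FiniteDimensional ℝ U] in
theorem continuous_multiplier {F : Type} [NormedAddCommGroup F] [NormedSpace ℝ F]
    {K : U × V → ℂ →L[ℝ] F} (hK : K.HasTemperateGrowth) (f : 𝓢(U × V, ℂ)) (u : U) :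
    Continuous fun y => K (u, y) (𝓕 (slice f u) y) :=
  (hK.1.continuous.comp (by fun_prop : Continuous fun y : V => (u, y))).clm_apply
    (𝓕 (slice f u)).continuous

omit [FiniteDimensional ℝ U] in
theorem integrable_multiplier {F : Type} [NormedAddCommGroup F] [NormedSpace ℝ F]
    {K : U × V → ℂ →L[ℝ] F} (hK : K.HasTemperateGrowth) (f : 𝓢(U × V, ℂ)) (u : U) :
    Integrable fun y => K (u, y) (𝓕 (slice f u) y) := by
  obtain ⟨C, hC⟩ := exists_local_bound_multiplier hK f u
  exact integrable_of_one_add_norm_pow_bound (continuous_multiplier hK f u).aestronglyMeasurable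
    (hC u (Metric.mem_ball_self one_pos))

/-- By the product rule, integrals of this form are closed under differentiation in `u`, with values
in `U →L[ℝ] F` in place of `F`. Hence `F`, `K` and `f` are all quantified inside the induction on
`n`. -/
theorem contDiff_integral_fourier_slice (n : ℕ) :
    ∀ {F : Type} [NormedAddCommGroup F] [NormedSpace ℝ F] {K : U × V → ℂ →L[ℝ] F}
      (_ : K.HasTemperateGrowth) (f : 𝓢(U × V, ℂ)),
      ContDiff ℝ n fun u => ∫ y, K (u, y) (𝓕 (slice f u) y) := by
  have B := Module.finBasis ℝ U
  have hderiv : ∀ {F : Type} [NormedAddCommGroup F] [NormedSpace ℝ F] {K : U × V → ℂ →L[ℝ] F}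
      (_ : K.HasTemperateGrowth) (f : 𝓢(U × V, ℂ)),
      ∃ (K₁ : U × V → ℂ →L[ℝ] U →L[ℝ] F)
        (K₂ : Fin (Module.finrank ℝ U) → U × V → ℂ →L[ℝ] U →L[ℝ] F),
        K₁.HasTemperateGrowth ∧ (∀ i, (K₂ i).HasTemperateGrowth) ∧ ∀ u,
        HasFDerivAt (fun u => ∫ y, K (u, y) (𝓕 (slice f u) y))
          ((∫ y, K₁ (u, y) (𝓕 (slice f u) y)) +
            ∑ i, ∫ y, K₂ i (u, y) (𝓕 (slice (∂_{(B i, (0 : V))} f) u) y)) u := by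
    intro F _ _ K hK f
    -- `L₁` restricts the derivative of `K` to directions in `U` and swaps its two arguments; `L₂ i`
    -- tensors `K` with the `i`-th coordinate. Both are bounded linear, so temperate growth is
    -- inherited.
    let L₁ : (U × V →L[ℝ] ℂ →L[ℝ] F) →L[ℝ] ℂ →L[ℝ] U →L[ℝ] F :=
      (ContinuousLinearMap.flipₗᵢ ℝ U ℂ F).toContinuousLinearEquiv.toContinuousLinearMap ∘L
        ((ContinuousLinearMap.compL ℝ U (U × V) (ℂ →L[ℝ] F)).flip
          (ContinuousLinearMap.inl ℝ U V))
    let L₂ : Fin (Module.finrank ℝ U) → (ℂ →L[ℝ] F) →L[ℝ] ℂ →L[ℝ] U →L[ℝ] F := fun i =>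
      ContinuousLinearMap.compL ℝ ℂ F (U →L[ℝ] F)
        (ContinuousLinearMap.smulRightL ℝ U F (coordCLM B i))
    set K₁ : U × V → ℂ →L[ℝ] U →L[ℝ] F := fun z => L₁ (fderiv ℝ K z) with hK₁
    set K₂ : Fin (Module.finrank ℝ U) → U × V → ℂ →L[ℝ] U →L[ℝ] F := fun i z => L₂ i (K z) with hK₂
    have h1 : K₁.HasTemperateGrowth := by
      have h := hasTemperateGrowth_clm_comp (B := ℂ →L[ℝ] U →L[ℝ] F) L₁
        (hasTemperateGrowth_fderiv hK)
      exact h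
    have h2 : ∀ i, (K₂ i).HasTemperateGrowth := fun i => by
      have h := hasTemperateGrowth_clm_comp (B := ℂ →L[ℝ] U →L[ℝ] F) (L₂ i) hK
      exact h
    refine ⟨K₁, K₂, h1, h2, fun u₀ => ?_⟩
    rw [← integral_finsetSum _ fun i _ => integrable_multiplier (h2 i) _ u₀,
      ← integral_add (integrable_multiplier h1 f u₀)
        (integrable_finsetSum _ fun i _ => integrable_multiplier (h2 i) _ u₀)]
    obtain ⟨C₁, hC₁⟩ := exists_local_bound_multiplier h1 f u₀
    choose C₂ hC₂ using fun i => exists_local_bound_multiplier (h2 i) (∂_{(B i, (0 : V))} f) u₀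
    refine hasFDerivAt_integral_of_dominated_of_fderiv_le
      (F := fun u y => K (u, y) (𝓕 (slice f u) y))
      (F' := fun u y => K₁ (u, y) (𝓕 (slice f u) y) +
            ∑ i, K₂ i (u, y) (𝓕 (slice (∂_{(B i, (0 : V))} f) u) y))
      (s := Metric.ball u₀ 1) (bound := fun y => (C₁ + ∑ i, C₂ i) *
      (1 + ‖y‖) ^ (-((Module.finrank ℝ V + 1 : ℕ) : ℝ))) (Metric.ball_mem_nhds _ one_pos)
      (Filter.Eventually.of_forall fun u => (continuous_multiplier hK f u).aestronglyMeasurable)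
      (integrable_multiplier hK f u₀) ?_ ?_ ?_ ?_
    · exact ((continuous_multiplier h1 f u₀).add (continuous_finsetSum _ fun i _ =>
        continuous_multiplier (h2 i) _ u₀)).aestronglyMeasurable
    · refine Filter.Eventually.of_forall fun y u hu => ?_
      rw [Real.rpow_neg (by positivity), Real.rpow_natCast, ← div_eq_mul_inv,
        le_div_iff₀ (by positivity), mul_comm]
      refine (mul_le_mul_of_nonneg_left ((norm_add_le _ _).trans
        (add_le_add_right (norm_sum_le _ _) _)) (by positivity)).trans ?_
      rw [mul_add, Finset.mul_sum]
      exact add_le_add (hC₁ u hu y) (Finset.sum_le_sum fun i _ => hC₂ i u hu y)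
    · exact (integrable_one_add_norm (by norm_num)).const_mul _
    · refine Filter.Eventually.of_forall fun y u _ => ?_
      have hd : HasFDerivAt (fun u => K (u, y))
          ((fderiv ℝ K (u, y)).comp (ContinuousLinearMap.inl ℝ U V)) u :=
        ((hK.1.differentiable (by simp)) (u, y)).hasFDerivAt.comp u (hasFDerivAt_prodMk_left u y)
      refine (hd.clm_apply (hasFDerivAt_fourier_slice B f u y)).congr_fderiv ?_
      ext v
      simp only [hK₁, hK₂, L₁, L₂, _root_.add_apply, _root_.sum_apply,
        ContinuousLinearMap.comp_apply, map_sum, ContinuousLinearMap.smulRight_apply, map_smul]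
      simp [add_comm]
  induction n with
  | zero =>
    intro F _ _ K hK f
    obtain ⟨K₁, K₂, -, -, h⟩ := hderiv hK f
    simp only [CharP.cast_eq_zero]
    exact contDiff_zero.2 (continuous_iff_continuousAt.2 fun u => (h u).continuousAt)
  | succ n ih =>
    intro F _ _ K hK f
    obtain ⟨K₁, K₂, h1, h2, h⟩ := hderiv hK f
    rw [Nat.cast_succ, contDiff_succ_iff_hasFDerivAt]
    exact ⟨_, (ih h1 f).add (ContDiff.sum fun i _ => ih (h2 i) _), h⟩

end Slices

/-! ### The entire function `z ↦ Ψ_ν(√z)` and its cut-off. -/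

section Bessel

/-- The Taylor coefficients of `z ↦ Ψ_ν(√z)`. -/
def besselCoeff (ν : ℝ) (m : ℕ) : ℝ :=
  (∏ i ∈ Finset.range m, -(1 / (4 * (ν + i + 1)))) / m.factorial

/-- The entire function `z ↦ Ψ_ν(√z)`. -/
def besselEntire (ν z : ℝ) : ℝ := ∑' m : ℕ, besselCoeff ν m * z ^ m

/-- Each factor `1 / (4(ν + i + 1))` is at most one when `ν ≥ 0`; comparison with the exponential
series is all that convergence and termwise differentiation need. -/
theorem abs_besselCoeff_le {ν : ℝ} (hν : 0 ≤ ν) (m : ℕ) : |besselCoeff ν m| ≤ 1 / m.factorial := by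
  rw [besselCoeff, abs_div, Nat.abs_cast]
  gcongr
  rw [Finset.abs_prod]
  refine Finset.prod_le_one (fun i _ => abs_nonneg _) fun i _ => ?_
  rw [abs_neg, abs_of_nonneg (by positivity), div_le_one (by positivity)]
  have : (0 : ℝ) ≤ i := Nat.cast_nonneg i
  linarith

theorem summable_besselCoeff_mul_pow {ν : ℝ} (hν : 0 ≤ ν) (z : ℝ) :
    Summable fun m : ℕ => besselCoeff ν m * z ^ m := by
  refine Summable.of_norm_bounded (Real.summable_pow_div_factorial |z|) fun m => ?_
  rw [norm_mul, norm_pow, Real.norm_eq_abs, Real.norm_eq_abs, div_eq_inv_mul, ← one_div]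
  gcongr
  exact abs_besselCoeff_le hν m

theorem succ_mul_besselCoeff (ν : ℝ) (m : ℕ) :
    (m + 1) * besselCoeff ν (m + 1) = -(1 / (4 * (ν + 1))) * besselCoeff (ν + 1) m := by
  rw [besselCoeff, besselCoeff, Finset.prod_range_succ', Nat.factorial_succ]
  have h1 : (m.factorial : ℝ) ≠ 0 := by positivity
  have h2 : ((m : ℝ) + 1) ≠ 0 := by positivity
  have h3 : ∀ i : ℕ, -(1 / (4 * (ν + ((i + 1 : ℕ) : ℝ) + 1))) = -(1 / (4 * (ν + 1 + i + 1))) := by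
    intro i; push_cast; ring_nf
  simp only [h3]
  push_cast
  field_simp
  ring_nf

/-- Termwise differentiation shifts the coefficients to those of `ν + 1`; this reduces control of
all derivatives to control of the functions themselves. -/
theorem hasDerivAt_besselEntire {ν : ℝ} (hν : 0 ≤ ν) (z : ℝ) :
    HasDerivAt (besselEntire ν) (-(1 / (4 * (ν + 1))) * besselEntire (ν + 1) z) z := by
  set R : ℝ := |z| + 1
  have hu : Summable fun n : ℕ => (n : ℝ) / n.factorial * R ^ (n - 1) := by
    rw [← summable_nat_add_iff 1]
    refine (Real.summable_pow_div_factorial R).congr fun n => ?_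
    rw [Nat.factorial_succ]
    push_cast
    have h1 : (n.factorial : ℝ) ≠ 0 := by positivity
    have h2 : ((n : ℝ) + 1) ≠ 0 := by positivity
    field_simp
  have hz : z ∈ Metric.ball (0 : ℝ) R := by simp [R]
  have key := hasDerivAt_tsum_of_isPreconnected (g := fun (n : ℕ) y => besselCoeff ν n * y ^ n)
    (g' := fun (n : ℕ) y => besselCoeff ν n * (n * y ^ (n - 1))) (t := Metric.ball (0 : ℝ) R)
    (y₀ := z) (y := z) hu Metric.isOpen_ball (convex_ball (0 : ℝ) R).isPreconnected
    (fun n y _ => (hasDerivAt_pow n y).const_mul _) ?_ hz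
    (summable_besselCoeff_mul_pow hν z) hz
  · refine key.congr_deriv ?_
    rw [besselEntire, ← tsum_mul_left, tsum_eq_zero_add']
    · simp only [Nat.cast_zero, zero_mul, mul_zero, zero_add]
      refine tsum_congr fun n => ?_
      rw [← mul_assoc, ← mul_assoc, ← succ_mul_besselCoeff, Nat.add_sub_cancel]
      push_cast
      ring
    · refine ((summable_besselCoeff_mul_pow (ν := ν + 1) (by linarith) z).mul_left
        (-(1 / (4 * (ν + 1))))).congr fun n => ?_
      rw [← mul_assoc, ← mul_assoc, ← succ_mul_besselCoeff, Nat.add_sub_cancel]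
      push_cast
      ring
  · intro n y hy
    have hy' : |y| ≤ R := by
      have := Metric.mem_ball.1 hy
      rw [Real.dist_eq, sub_zero] at this
      exact this.le
    rw [norm_mul, norm_mul, norm_pow, Real.norm_eq_abs, Real.norm_eq_abs, Real.norm_eq_abs,
      Nat.abs_cast, ← mul_assoc, div_eq_inv_mul, ← one_div]
    gcongr
    exact abs_besselCoeff_le hν n

theorem contDiff_besselEntire {ν : ℝ} (hν : 0 ≤ ν) (n : ℕ∞) : ContDiff ℝ n (besselEntire ν) := by
  have key : ∀ (n : ℕ) (ν : ℝ), 0 ≤ ν → ContDiff ℝ n (besselEntire ν) := by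
    intro n
    induction n with
    | zero =>
      intro ν hν
      simp only [CharP.cast_eq_zero]
      exact contDiff_zero.2 (continuous_iff_continuousAt.2 fun z =>
        (hasDerivAt_besselEntire hν z).continuousAt)
    | succ n ih =>
      intro ν hν
      rw [Nat.cast_succ, contDiff_succ_iff_deriv]
      refine ⟨fun z => (hasDerivAt_besselEntire hν z).differentiableAt, by simp, ?_⟩
      rw [funext fun z => (hasDerivAt_besselEntire hν z).deriv]
      exact contDiff_const.mul (ih (ν + 1) (by linarith))
  have h : ContDiff ℝ ∞ (besselEntire ν) := contDiff_infty.2 fun n => key n ν hν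
  exact h.of_le (by exact_mod_cast le_top)

theorem exists_iteratedDeriv_besselEntire (n : ℕ) : ∀ {ν : ℝ}, 0 ≤ ν →
    ∃ c, iteratedDeriv n (besselEntire ν) = fun z => c * besselEntire (ν + n) z := by
  induction n with
  | zero => intro ν _; exact ⟨1, by simp [iteratedDeriv_zero]⟩
  | succ n ih =>
    intro ν hν
    obtain ⟨c, hc⟩ := ih (ν := ν + 1) (by linarith)
    refine ⟨-(1 / (4 * (ν + 1))) * c, ?_⟩
    rw [iteratedDeriv_succ', funext fun z => (hasDerivAt_besselEntire hν z).deriv]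
    funext z
    rw [iteratedDeriv_const_mul_field, hc]
    push_cast
    ring_nf

theorem besselCoeff_eq_gamma {ν : ℝ} (hν : 0 ≤ ν) (m : ℕ) :
    besselCoeff ν m =
      Real.Gamma (ν + 1) * ((-1) ^ m / (m.factorial * Real.Gamma (m + ν + 1))) * (1 / 4) ^ m := by
  have key : ∏ i ∈ Finset.range m, -(1 / (4 * (ν + i + 1))) =
      (-1) ^ m * Real.Gamma (ν + 1) / Real.Gamma (m + ν + 1) * (1 / 4) ^ m := by
    induction m with
    | zero =>
      have : Real.Gamma (ν + 1) ≠ 0 := (Real.Gamma_pos_of_pos (by linarith)).ne'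
      simp [this]
    | succ m ih =>
      have h0 : (0 : ℝ) < m + ν + 1 := by positivity
      have h1 : Real.Gamma (m + ν + 1) ≠ 0 := (Real.Gamma_pos_of_pos h0).ne'
      have h2 : Real.Gamma (((m + 1 : ℕ) : ℝ) + ν + 1) = (m + ν + 1) * Real.Gamma (m + ν + 1) := by
        rw [← Real.Gamma_add_one h0.ne']; push_cast; ring_nf
      rw [Finset.prod_range_succ, ih, h2]
      have h3 : (m + ν + 1 : ℝ) ≠ 0 := h0.ne'
      have h4 : (ν + m + 1 : ℝ) ≠ 0 := by rw [add_comm ν]; exact h3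
      field_simp
      ring
  rw [besselCoeff, key]
  ring

theorem besselPsi_eq {ν : ℝ} (hν : 0 ≤ ν) {x : ℝ} (hx : 0 ≤ x) :
    besselPsi ν x = besselEntire ν (x ^ 2) := by
  rw [besselPsi]
  split_ifs with h
  · rw [besselEntire, tsum_eq_single 0]
    · simp [besselCoeff]
    · intro m hm
      simp [h, hm]
  · have hx' : 0 < x / 2 := by positivity
    have hne : (x / 2) ^ ν ≠ 0 := (Real.rpow_pos_of_pos hx' ν).ne'
    rw [besselJ, besselEntire, mul_div_assoc, ← tsum_div_const, ← tsum_mul_left]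
    refine tsum_congr fun m => ?_
    rw [Real.rpow_add hx', besselCoeff_eq_gamma hν,
      show (2 * (m : ℝ)) = ((2 * m : ℕ) : ℝ) by push_cast; ring, Real.rpow_natCast, ← pow_mul,
      div_pow, one_div, inv_pow, pow_mul 2 2 m]
    field_simp
    norm_num

/-- The cut-off is `1` for `z ≥ 0` and `0` for `z ≤ -1`, and the interval between is compact. It is
needed because only bounds on `[0, ∞)` are assumed for `h`, while the symbol can be negative. -/
theorem hasTemperateGrowth_smoothTransition_mul {h : ℝ → ℝ} (hc : ContDiff ℝ ∞ h)
    (hb : ∀ n : ℕ, ∃ C, ∀ z, 0 ≤ z → |iteratedDeriv n h z| ≤ C) :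
    Function.HasTemperateGrowth fun z => Real.smoothTransition (z + 1) * h z := by
  have hg : ContDiff ℝ ∞ fun z => Real.smoothTransition (z + 1) * h z :=
    (Real.smoothTransition.contDiff.comp (contDiff_id.add contDiff_const)).mul hc
  refine ⟨hg, fun n => ?_⟩
  obtain ⟨C, hC⟩ := hb n
  obtain ⟨C', hC'⟩ := (isCompact_Icc (a := (-1 : ℝ)) (b := 0)).exists_bound_of_continuousOn
    ((hg.continuous_iteratedDeriv n (by exact_mod_cast le_top)).continuousOn)
  refine ⟨0, max C C', fun z => ?_⟩
  rw [norm_iteratedFDeriv_eq_norm_iteratedDeriv, pow_zero, mul_one]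
  rcases lt_or_ge 0 z with hz | hz
  · have : (fun z => Real.smoothTransition (z + 1) * h z) =ᶠ[nhds z] h := by
      filter_upwards [lt_mem_nhds hz] with y hy
      rw [Real.smoothTransition.one_of_one_le (by linarith), one_mul]
    rw [this.iteratedDeriv_eq]
    exact (hC z hz.le).trans (le_max_left _ _)
  · rcases lt_or_ge z (-1) with hz' | hz'
    · have : (fun z => Real.smoothTransition (z + 1) * h z) =ᶠ[nhds z] fun _ => 0 := by
        filter_upwards [gt_mem_nhds hz'] with y hy
        rw [Real.smoothTransition.zero_of_nonpos (by linarith), zero_mul]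
      rw [this.iteratedDeriv_eq]
      have h0 : 0 ≤ C' := (norm_nonneg _).trans (hC' (-1) (by simp))
      simp [h0]
    · exact (hC' z ⟨hz', hz⟩).trans (le_max_right _ _)

end Bessel

/-! ### Moments and Fourier transform of the uniform measure on a sphere. -/

section Sphere

theorem coeff_two_one_add_sq_pow (m : ℕ) :
    ((1 + Polynomial.X ^ 2 : Polynomial ℝ) ^ (m + 1)).coeff 2 = m + 1 := by
  have h : (1 + Polynomial.X ^ 2 : Polynomial ℝ) ^ (m + 1) =
      Polynomial.expand ℝ 2 ((1 + Polynomial.X) ^ (m + 1)) := by simp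
  have h2 := Polynomial.coeff_expand_mul (R := ℝ) two_pos ((1 + Polynomial.X) ^ (m + 1)) 1
  rw [one_mul] at h2
  rw [h, h2, Polynomial.coeff_one_add_X_pow]
  simp

/-- If `E (A + s B)^(2m+2) = c (1 + s²)^(m+1)` for all `s`, then `(2m+1) E (A^(2m) B²) = c`. -/
theorem mixed_moment_eq {Ω : Type*} [MeasurableSpace Ω] {μ : Measure Ω} {A B : Ω → ℝ} {c : ℝ}
    {m : ℕ} (hint : ∀ k l : ℕ, Integrable (fun w => A w ^ k * B w ^ l) μ)
    (h : ∀ s : ℝ, ∫ w, (A w + s * B w) ^ (2 * m + 2) ∂μ = c * (1 + s ^ 2) ^ (m + 1)) :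
    (2 * m + 1) * ∫ w, A w ^ (2 * m) * B w ^ 2 ∂μ = c := by
  set N := 2 * m + 2 with hN
  -- Both sides are polynomials in `s`. Comparing coefficients of `s²` gives the claim, because
  -- `(2m+2).choose 2 = (m+1)(2m+1)`.
  set P : Polynomial ℝ := ∑ k ∈ Finset.range (N + 1),
    Polynomial.C (N.choose k * ∫ w, A w ^ (N - k) * B w ^ k ∂μ) * Polynomial.X ^ k with hP
  have hPQ : P = Polynomial.C c * (1 + Polynomial.X ^ 2) ^ (m + 1) := by
    refine Polynomial.funext fun s => ?_
    simp only [hP, Polynomial.eval_finsetSum, Polynomial.eval_mul, Polynomial.eval_C,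
      Polynomial.eval_pow, Polynomial.eval_X, Polynomial.eval_add, Polynomial.eval_one]
    rw [← h s]
    have : ∀ w, (A w + s * B w) ^ N = ∑ k ∈ Finset.range (N + 1),
        (N.choose k * s ^ k) * (A w ^ (N - k) * B w ^ k) := by
      intro w
      rw [add_comm, add_pow]
      exact Finset.sum_congr rfl fun k _ => by rw [mul_pow]; ring
    simp only [this]
    rw [integral_finsetSum _ fun k _ => (hint _ _).const_mul _]
    refine Finset.sum_congr rfl fun k _ => ?_
    rw [integral_const_mul]
    ring
  have h2 : P.coeff 2 = N.choose 2 * ∫ w, A w ^ (N - 2) * B w ^ 2 ∂μ := by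
    rw [hP, Polynomial.finsetSum_coeff, Finset.sum_eq_single 2]
    · rw [Polynomial.coeff_C_mul_X_pow, if_pos rfl]
    · intro k _ hk
      rw [Polynomial.coeff_C_mul_X_pow, if_neg hk.symm]
    · intro h; exact absurd (Finset.mem_range.2 (by omega)) h
  rw [hPQ, Polynomial.coeff_C_mul, coeff_two_one_add_sq_pow] at h2
  have h3 : (N.choose 2 : ℝ) = (m + 1) * (2 * m + 1) := by
    rw [Nat.cast_choose_two, hN]; push_cast; ring
  have h4 : N - 2 = 2 * m := by omega
  rw [h3, h4] at h2
  have h5 : ((m : ℝ) + 1) ≠ 0 := by positivity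
  apply mul_left_cancel₀ h5
  linarith

variable {ι : Type*} [Fintype ι] [DecidableEq ι] {Ω : Type*} [MeasurableSpace Ω] {μ : Measure Ω}
  [IsProbabilityMeasure μ] {X : Ω → EuclideanSpace ℝ ι} {S : Finset ι}

omit [DecidableEq ι] in
theorem inner_eq_sum_of_support {x y : EuclideanSpace ℝ ι} (hx : ∀ i ∉ S, x i = 0) :
    inner ℝ y x = ∑ i ∈ S, y i * x i := by
  rw [PiLp.inner_apply, ← Finset.sum_subset (Finset.subset_univ S)]
  · exact Finset.sum_congr rfl fun i _ => by simp [mul_comm]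
  · intro i _ hi
    simp [hx i hi]

/-- The moments `E ⟨y, X⟩^m` of a random vector on the unit sphere of a coordinate subspace which
depend on the norm of `y` only. -/
theorem moment_eq (hX : ∀ w, ∀ i ∉ S, X w i = 0)
    (hinv : ∀ y y' : EuclideanSpace ℝ ι, ‖y‖ = 1 → ‖y'‖ = 1 → (∀ i ∉ S, y i = 0) →
      (∀ i ∉ S, y' i = 0) → ∀ m : ℕ, ∫ w, inner ℝ y (X w) ^ m ∂μ = ∫ w, inner ℝ y' (X w) ^ m ∂μ)
    {i₀ : ι} (hi₀ : i₀ ∈ S) (y : EuclideanSpace ℝ ι) (m : ℕ) :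
    ∫ w, inner ℝ y (X w) ^ m ∂μ =
      (∫ w, X w i₀ ^ m ∂μ) * √(∑ i ∈ S, y i ^ 2) ^ m := by
  set r := √(∑ i ∈ S, y i ^ 2) with hr
  have hr2 : r ^ 2 = ∑ i ∈ S, y i ^ 2 := Real.sq_sqrt (Finset.sum_nonneg fun i _ => sq_nonneg _)
  have hr0 : 0 ≤ r := Real.sqrt_nonneg _
  have h1 : ∀ w, X w i₀ = inner ℝ (EuclideanSpace.single i₀ (1 : ℝ)) (X w) := fun w => by
    simp [EuclideanSpace.inner_single_left]
  rcases eq_or_lt_of_le hr0 with h0 | hpos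
  · have hy : ∀ i ∈ S, y i = 0 := by
      intro i hi
      have h2 : ∑ i ∈ S, y i ^ 2 = 0 := by rw [← hr2, ← h0]; ring
      exact pow_eq_zero_iff two_ne_zero |>.1
        ((Finset.sum_eq_zero_iff_of_nonneg fun i _ => sq_nonneg _).1 h2 i hi)
    have hz : ∀ w, inner ℝ y (X w) = 0 := fun w => by
      rw [inner_eq_sum_of_support (hX w)]
      exact Finset.sum_eq_zero fun i hi => by rw [hy i hi, zero_mul]
    rcases Nat.eq_zero_or_pos m with rfl | hm
    · simp
    · simp [hz, ← h0, hm.ne']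
  -- `y'` is the normalized projection of `y` to the coordinates in `S`, so invariance lets it be
  -- exchanged for the basis vector `i₀`.
  · set y' : EuclideanSpace ℝ ι := WithLp.toLp 2 fun i => if i ∈ S then r⁻¹ * y i else 0 with hy'
    have hsupp : ∀ i ∉ S, y' i = 0 := fun i hi => by simp [hy', hi]
    have hn : ‖y'‖ = 1 := by
      rw [← sq_eq_sq₀ (norm_nonneg _) zero_le_one, EuclideanSpace.real_norm_sq_eq,
        ← Finset.sum_subset (Finset.subset_univ S)]
      · have : ∀ i ∈ S, y' i ^ 2 = r⁻¹ ^ 2 * y i ^ 2 := fun i hi => by simp [hy', hi, mul_pow]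
        rw [Finset.sum_congr rfl this, ← Finset.mul_sum, ← hr2]
        field_simp
      · intro i _ hi
        rw [hsupp i hi]; ring
    have hin : ∀ w, inner ℝ y (X w) = r * inner ℝ y' (X w) := fun w => by
      rw [inner_eq_sum_of_support (hX w), inner_eq_sum_of_support (hX w), Finset.mul_sum]
      refine Finset.sum_congr rfl fun i hi => ?_
      have : y' i = r⁻¹ * y i := by simp [hy', hi]
      rw [this]
      field_simp
    simp only [hin, mul_pow, h1]
    rw [integral_const_mul, mul_comm, hinv y' (EuclideanSpace.single i₀ 1) hn (by simp) hsupp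
      (fun i hi => by
        have : i ≠ i₀ := fun h => hi (h ▸ hi₀)
        simp [this]) m]

/-- Multiply `X_{i₀}^(2m)` by `1 = ∑ X_i²` and integrate. Each of the `|S| - 1` mixed moments is
`1/(2m+1)` times the moment of order `2m + 2`, by `mixed_moment_eq`. -/
theorem moment_recursion (hXm : AEStronglyMeasurable X μ) (hX1 : ∀ w, ‖X w‖ = 1)
    (hX : ∀ w, ∀ i ∉ S, X w i = 0)
    (hinv : ∀ y y' : EuclideanSpace ℝ ι, ‖y‖ = 1 → ‖y'‖ = 1 → (∀ i ∉ S, y i = 0) →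
      (∀ i ∉ S, y' i = 0) → ∀ m : ℕ, ∫ w, inner ℝ y (X w) ^ m ∂μ = ∫ w, inner ℝ y' (X w) ^ m ∂μ)
    {i₀ : ι} (hi₀ : i₀ ∈ S) (m : ℕ) :
    (2 * m + S.card) * ∫ w, X w i₀ ^ (2 * m + 2) ∂μ = (2 * m + 1) * ∫ w, X w i₀ ^ (2 * m) ∂μ := by
  have hcoord : ∀ i, AEStronglyMeasurable (fun w => X w i) μ := fun i =>
    (EuclideanSpace.proj (𝕜 := ℝ) i).continuous.comp_aestronglyMeasurable hXm
  have hle : ∀ w i, |X w i| ≤ 1 := fun w i => by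
    rw [← hX1 w, ← Real.norm_eq_abs]; exact PiLp.norm_apply_le _ _
  have hint : ∀ i i' (k l : ℕ), Integrable (fun w => X w i ^ k * X w i' ^ l) μ := by
    intro i i' k l
    refine Integrable.of_bound (((hcoord i).pow k).mul ((hcoord i').pow l)) 1
      (Filter.Eventually.of_forall fun w => ?_)
    rw [norm_mul, norm_pow, norm_pow]
    exact mul_le_one₀ (pow_le_one₀ (norm_nonneg _) (hle w i)) (by positivity)
      (pow_le_one₀ (norm_nonneg _) (hle w i'))
  have hmix : ∀ i ∈ S.erase i₀, (2 * m + 1) * ∫ w, X w i₀ ^ (2 * m) * X w i ^ 2 ∂μ =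
      ∫ w, X w i₀ ^ (2 * m + 2) ∂μ := by
    intro i hi
    obtain ⟨hne, hiS⟩ := Finset.mem_erase.1 hi
    refine mixed_moment_eq (hint i₀ i) fun s => ?_
    -- This vector has squared norm `1 + s²`, so `moment_eq` provides the hypothesis of
    -- `mixed_moment_eq`.
    set y : EuclideanSpace ℝ ι := EuclideanSpace.single i₀ 1 + s • EuclideanSpace.single i 1 with hy
    have h1 : ∀ w, X w i₀ + s * X w i = inner ℝ y (X w) := fun w => by
      rw [hy, inner_add_left, inner_smul_left]
      simp [EuclideanSpace.inner_single_left]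
    simp only [h1]
    rw [moment_eq hX hinv hi₀, show 2 * m + 2 = 2 * (m + 1) by ring, pow_mul √_ 2,
      Real.sq_sqrt (Finset.sum_nonneg fun i _ => sq_nonneg _)]
    congr 2
    rw [← Finset.add_sum_erase S _ hi₀, ← Finset.add_sum_erase (S.erase i₀) _ hi,
      Finset.sum_eq_zero]
    · simp [hy, hne, hne.symm]
    · intro i' hi'
      simp only [Finset.mem_erase] at hi'
      simp [hy, hi'.1, hi'.2.1]
  have hsum : ∀ w, X w i₀ ^ 2 + ∑ i ∈ S.erase i₀, X w i ^ 2 = 1 := fun w => by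
    rw [Finset.add_sum_erase S (fun i => X w i ^ 2) hi₀,
      Finset.sum_subset (Finset.subset_univ S) fun i _ hi => by rw [hX w i hi]; ring,
      ← EuclideanSpace.real_norm_sq_eq, hX1 w, one_pow]
  have htot : ∫ w, X w i₀ ^ (2 * m) ∂μ = (∫ w, X w i₀ ^ (2 * m + 2) ∂μ) +
      ∑ i ∈ S.erase i₀, ∫ w, X w i₀ ^ (2 * m) * X w i ^ 2 ∂μ := by
    rw [← integral_finsetSum _ fun i _ => hint i₀ i _ _, ← integral_add]
    · refine integral_congr_ae (Filter.Eventually.of_forall fun w => ?_)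
      simp only
      rw [← Finset.mul_sum, pow_add, ← mul_add, hsum, mul_one]
    · simpa using hint i₀ i₀ (2 * m + 2) 0
    · exact integrable_finsetSum _ fun i _ => hint i₀ i _ _
  have hcard : ((S.erase i₀).card : ℝ) = S.card - 1 := by
    rw [Finset.card_erase_of_mem hi₀, Nat.cast_sub (Finset.card_pos.2 ⟨i₀, hi₀⟩), Nat.cast_one]
  rw [htot, mul_add, Finset.mul_sum, Finset.sum_congr rfl hmix, Finset.sum_const, nsmul_eq_mul,
    hcard]
  ring

/-- The Fourier transform of the rotation invariant probability measure on a unit sphere. -/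
theorem integral_exp_inner_eq (hXm : AEStronglyMeasurable X μ) (hX1 : ∀ w, ‖X w‖ = 1)
    (hX : ∀ w, ∀ i ∉ S, X w i = 0)
    (hinv : ∀ y y' : EuclideanSpace ℝ ι, ‖y‖ = 1 → ‖y'‖ = 1 → (∀ i ∉ S, y i = 0) →
      (∀ i ∉ S, y' i = 0) → ∀ m : ℕ, ∫ w, inner ℝ y (X w) ^ m ∂μ = ∫ w, inner ℝ y' (X w) ^ m ∂μ)
    (hS : 2 ≤ S.card) (y : EuclideanSpace ℝ ι) :
    ∫ w, Complex.exp (-(Complex.I * (inner ℝ y (X w) : ℝ))) ∂μ =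
      (besselEntire (S.card / 2 - 1) (∑ i ∈ S, y i ^ 2) : ℝ) := by
  obtain ⟨i₀, hi₀⟩ : S.Nonempty := Finset.card_pos.1 (by omega)
  set A : ℕ → ℝ := fun m => ∫ w, X w i₀ ^ m ∂μ with hA
  set q := ∑ i ∈ S, y i ^ 2 with hq
  -- Invariance under exchanging the basis vector with its negative.
  have hodd : ∀ m, A (2 * m + 1) = 0 := by
    intro m
    have h := hinv (EuclideanSpace.single i₀ 1) (-EuclideanSpace.single i₀ 1) (by simp) (by simp)
      (fun i hi => by
        have : i ≠ i₀ := fun h => hi (h ▸ hi₀)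
        simp [this])
      (fun i hi => by
        have : i ≠ i₀ := fun h => hi (h ▸ hi₀)
        simp [this]) (2 * m + 1)
    simp only [inner_neg_left, EuclideanSpace.inner_single_left, map_one, one_mul,
      Odd.neg_pow ⟨m, rfl⟩, integral_neg] at h
    simp only [hA]
    linarith
  have hS' : (2 : ℝ) ≤ S.card := by exact_mod_cast hS
  have hν : (0 : ℝ) ≤ S.card / 2 - 1 := by linarith
  have heven : ∀ m : ℕ, (-1) ^ m * A (2 * m) / (2 * m).factorial =
      besselCoeff (S.card / 2 - 1) m := by
    intro m
    induction m with
    | zero => simp [hA, besselCoeff]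
    | succ m ih =>
      have hrec : (2 * m + S.card) * A (2 * m + 2) = (2 * m + 1) * A (2 * m) :=
        moment_recursion hXm hX1 hX hinv hi₀ m
      have h1 : besselCoeff (S.card / 2 - 1) (m + 1) = besselCoeff (S.card / 2 - 1) m *
          (-(1 / (4 * ((S.card : ℝ) / 2 - 1 + m + 1))) / (m + 1)) := by
        rw [besselCoeff, besselCoeff, Finset.prod_range_succ, Nat.factorial_succ]
        push_cast
        have : (m.factorial : ℝ) ≠ 0 := by positivity
        field_simp
      have hpos : (2 * m + S.card : ℝ) ≠ 0 := by positivity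
      have h2 : A (2 * (m + 1)) = (2 * m + 1) * A (2 * m) / (2 * m + S.card) := by
        rw [eq_div_iff hpos, mul_comm, show 2 * (m + 1) = 2 * m + 2 by ring, hrec]
      have h3 : (4 * ((S.card : ℝ) / 2 - 1 + m + 1)) = 2 * (2 * m + S.card) := by ring
      rw [h1, ← ih, h2, h3, show 2 * (m + 1) = 2 * m + 1 + 1 by ring, Nat.factorial_succ,
        Nat.factorial_succ]
      push_cast
      have h4 : ((2 * m).factorial : ℝ) ≠ 0 := by positivity
      have h5 : (2 * m + 1 : ℝ) ≠ 0 := by positivity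
      have h6 : (m + 1 : ℝ) ≠ 0 := by positivity
      have h7 : (2 * m + 1 + 1 : ℝ) ≠ 0 := by positivity
      field_simp
      ring
  have hmeas : AEStronglyMeasurable (fun w => inner ℝ y (X w)) μ :=
    (innerSL ℝ y).continuous.comp_aestronglyMeasurable hXm
  have hterm : ∀ k : ℕ, ∫ w, (-(Complex.I * (inner ℝ y (X w) : ℝ))) ^ k / (k.factorial : ℂ) ∂μ =
      (-Complex.I) ^ k / k.factorial * (A k * √q ^ k : ℝ) := by
    intro k
    rw [← moment_eq hX hinv hi₀ y k, ← integral_complex_ofReal, ← integral_const_mul]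
    refine integral_congr_ae (Filter.Eventually.of_forall fun w => ?_)
    simp only
    push_cast
    rw [← neg_mul, mul_pow]
    ring
  -- Since `‖X‖ = 1`, the exponential series is dominated by that of `‖y‖` and may be integrated
  -- termwise; only the even terms survive below.
  have hsum : HasSum (fun k : ℕ => ∫ w, (-(Complex.I * (inner ℝ y (X w) : ℝ))) ^ k /
      (k.factorial : ℂ) ∂μ) (∫ w, Complex.exp (-(Complex.I * (inner ℝ y (X w) : ℝ))) ∂μ) := by
    refine hasSum_integral_of_dominated_convergence (bound := fun k _ => ‖y‖ ^ k / k.factorial)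
      (fun k => ?_) (fun k => Filter.Eventually.of_forall fun w => ?_)
      (Filter.Eventually.of_forall fun w => Real.summable_pow_div_factorial _)
      (integrable_const _) (Filter.Eventually.of_forall fun w => ?_)
    · have : Continuous fun t : ℝ => (-(Complex.I * (t : ℂ))) ^ k / (k.factorial : ℂ) := by fun_prop
      exact this.comp_aestronglyMeasurable hmeas
    · rw [norm_div, norm_pow, norm_neg, norm_mul, Complex.norm_I, one_mul, Complex.norm_real,
        Complex.norm_natCast]
      gcongr
      exact (abs_real_inner_le_norm _ _).trans (by rw [hX1, mul_one])
    · rw [Complex.exp_eq_exp_ℂ]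
      exact NormedSpace.expSeries_div_hasSum_exp _
  simp only [hterm] at hsum
  have hinj : Function.Injective fun m : ℕ => 2 * m := fun a b h => by simpa using h
  rw [← hinj.hasSum_iff] at hsum
  · refine hsum.unique ?_
    rw [besselEntire]
    have hb := Complex.hasSum_ofReal.mpr (summable_besselCoeff_mul_pow hν q).hasSum
    convert hb using 1
    funext m
    have hqq : √q ^ (2 * m) = q ^ m := by
      rw [pow_mul, Real.sq_sqrt (Finset.sum_nonneg fun i _ => sq_nonneg _)]
    simp only [Function.comp_apply]
    rw [← heven, hqq, pow_mul, neg_sq, Complex.I_sq]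
    push_cast
    ring
  · intro k hk
    obtain ⟨m, rfl⟩ : Odd k := by
      rw [← Nat.not_even_iff_odd]
      rintro ⟨m, rfl⟩
      exact hk ⟨m, by simp only; ring⟩
    rw [hodd]
    simp

end Sphere

/-! ### The Fourier multiplier and its Schwartz extension. -/

section Multiplier

variable {b : Dyson} {n : ℕ}

instance neZero_beta (b : Dyson) : NeZero b.beta := ⟨by cases b <;> simp [Dyson.beta]⟩

/-- The linear map `y ↦ J^{(l)} y`. -/
def jMap (b : Dyson) (n : ℕ) (l : Fin b.beta) : Vec b n →ₗ[ℝ] Vec b n where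
  toFun y := WithLp.toLp 2 ((jMat b n l).mulVec y.ofLp)
  map_add' x y := by rw [WithLp.ofLp_add, Matrix.mulVec_add, WithLp.toLp_add]
  map_smul' c y := by
    rw [WithLp.ofLp_smul, Matrix.mulVec_smul, WithLp.toLp_smul, RingHom.id_apply]

theorem jMap_apply (l : Fin b.beta) (y : Vec b n) (p : Fin b.beta × Fin n) :
    jMap b n l y p = ∑ a, jBlock b l p.1 a * y (a, p.2) := by
  simp [jMap, jMat, Matrix.mulVec, dotProduct, Fintype.sum_prod_type, Matrix.one_apply]

theorem symbol_eq {j : ℕ} (u : Fin j → Vec b n) (y : Vec b n) :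
    symbol u y = ‖y‖ ^ 2 - ∑ i, ∑ l, inner ℝ (u i) (jMap b n l y) ^ 2 := rfl

theorem jMap_zero (y : Vec b n) : jMap b n 0 y = y := by
  ext p
  rw [jMap_apply]
  have h : jBlock b 0 = 1 := by
    cases b
    · ext i j; fin_cases i; fin_cases j; rfl
    · rfl
    · rfl
  simp [h, Matrix.one_apply]

/-- Test the symbol at `y = u i` and keep only the term with index `i` and `l = 0`: this gives `‖u
i‖⁴ ≤ ‖u i‖²`. Boundedness of the domain is what permits a compactly supported extension. -/
theorem norm_le_one_of_mem_nonnegDomain {j : ℕ} {u : Fin j → Vec b n}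
    (hu : u ∈ nonnegDomain b n j) : ‖u‖ ≤ 1 := by
  refine (pi_norm_le_iff_of_nonneg zero_le_one).2 fun i => ?_
  have h := hu (u i)
  rw [symbol_eq] at h
  have h1 : inner ℝ (u i) (jMap b n 0 (u i)) ^ 2 ≤
      ∑ i', ∑ l, inner ℝ (u i') (jMap b n l (u i)) ^ 2 :=
    (Finset.single_le_sum (f := fun l => inner ℝ (u i) (jMap b n l (u i)) ^ 2)
      (fun _ _ => sq_nonneg _) (Finset.mem_univ 0)).trans
      (Finset.single_le_sum (f := fun i' => ∑ l, inner ℝ (u i') (jMap b n l (u i)) ^ 2)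
        (fun _ _ => Finset.sum_nonneg fun _ _ => sq_nonneg _) (Finset.mem_univ i))
  rw [jMap_zero, real_inner_self_eq_norm_sq] at h1
  by_contra hlt
  push Not at hlt
  nlinarith [norm_nonneg (u i), mul_pos (sub_pos.2 hlt) (sub_pos.2 hlt)]

theorem hasTemperateGrowth_symbol (j : ℕ) :
    Function.HasTemperateGrowth fun z : (Fin j → Vec b n) × Vec b n => symbol z.1 z.2 := by
  simp only [symbol_eq]
  have hsnd : Function.HasTemperateGrowth fun z : (Fin j → Vec b n) × Vec b n => z.2 :=
    (ContinuousLinearMap.snd ℝ (Fin j → Vec b n) (Vec b n)).hasTemperateGrowth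
  refine Function.HasTemperateGrowth.sub
    ((Function.hasTemperateGrowth_norm_sq (Vec b n)).comp hsnd) ?_
  refine Function.HasTemperateGrowth.sum fun i _ => Function.HasTemperateGrowth.sum fun l _ => ?_
  refine Function.HasTemperateGrowth.pow ?_ 2
  have h1 : Function.HasTemperateGrowth fun z : (Fin j → Vec b n) × Vec b n => z.1 i :=
    ((ContinuousLinearMap.proj (R := ℝ) (φ := fun _ : Fin j => Vec b n) i).comp
      (ContinuousLinearMap.fst ℝ (Fin j → Vec b n) (Vec b n))).hasTemperateGrowth
  have h2 : Function.HasTemperateGrowth fun z : (Fin j → Vec b n) × Vec b n => jMap b n l z.2 :=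
    hasTemperateGrowth_clm_comp (LinearMap.toContinuousLinearMap (jMap b n l)) hsnd
  exact (innerSL ℝ (E := Vec b n)).bilinear_hasTemperateGrowth h1 h2

theorem continuous_symbol {j : ℕ} (u : Fin j → Vec b n) : Continuous fun y => symbol u y := by
  simp only [symbol_eq]
  have h : ∀ l, Continuous (jMap b n l) := fun l => LinearMap.continuous_of_finiteDimensional _
  fun_prop

/-- Appending a vector to a tuple, as a continuous linear equivalence. -/
def snocCLE (b : Dyson) (n j : ℕ) :
    ((Fin j → Vec b n) × Vec b n) ≃L[ℝ] (Fin (j + 1) → Vec b n) :=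
  LinearEquiv.toContinuousLinearEquiv
    { toFun := fun p => Fin.snoc (α := fun _ => Vec b n) p.1 p.2
      invFun := fun w => (Fin.init w, w (Fin.last j))
      left_inv := fun p => by simp
      right_inv := fun w => by simp
      map_add' := fun p q => by
        funext i
        refine Fin.lastCases ?_ (fun i => ?_) i <;> simp
      map_smul' := fun c p => by
        funext i
        refine Fin.lastCases ?_ (fun i => ?_) i <;> simp }

/-- A Schwartz function of `j + 1` vectors as a function of the first `j` and the last one. -/
def uncurryLast {j : ℕ} (f : 𝓢(Fin (j + 1) → Vec b n, ℂ)) : 𝓢((Fin j → Vec b n) × Vec b n, ℂ) :=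
  compCLMOfContinuousLinearEquiv ℂ (snocCLE b n j) f

theorem lastSlice_eq_slice {j : ℕ} (f : 𝓢(Fin (j + 1) → Vec b n, ℂ)) (u : Fin j → Vec b n) :
    lastSlice f u = slice (uncurryLast f) u := rfl

theorem finrank_vec (b : Dyson) (n : ℕ) : Module.finrank ℝ (Vec b n) = b.beta * n := by
  simp

theorem fourier_eq (g : Vec b n → ℂ) (y : Vec b n) :
    fourier g y = (((2 * Real.pi) ^ (b.beta * n))⁻¹ : ℝ) * 𝓕 g (-(2 * Real.pi)⁻¹ • y) := by
  rw [fourier, Real.fourier_eq']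
  congr 1
  refine integral_congr_ae (Filter.Eventually.of_forall fun x => ?_)
  simp only [smul_eq_mul]
  congr 2
  rw [inner_smul_right, real_inner_comm]
  have h : (Real.pi : ℂ) ≠ 0 := by exact_mod_cast Real.pi_ne_zero
  push_cast
  field_simp

/-- The substitution `y ↦ -2π y` passes between the two Fourier conventions; its Jacobian cancels
the factor `(2π)^(-βn)`. -/
theorem integral_mul_fourier (φ g : Vec b n → ℂ) :
    ∫ y, φ y * fourier g y = ∫ y, φ (-(2 * Real.pi) • y) * 𝓕 g y := by
  have h := Measure.integral_comp_smul (volume : Measure (Vec b n))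
    (fun y => φ y * 𝓕 g (-(2 * Real.pi)⁻¹ • y)) (-(2 * Real.pi))
  have h2 : ∀ y : Vec b n, -(2 * Real.pi)⁻¹ • -(2 * Real.pi) • y = y := fun y => by
    rw [smul_smul, neg_mul_neg, inv_mul_cancel₀ (by positivity), one_smul]
  simp only [h2] at h
  have h3 : |((-(2 * Real.pi)) ^ Module.finrank ℝ (Vec b n))⁻¹| =
      ((2 * Real.pi) ^ (b.beta * n))⁻¹ := by
    rw [finrank_vec, abs_inv, abs_pow, abs_neg, abs_of_nonneg (by positivity)]
  rw [h, h3, Complex.real_smul, ← integral_const_mul]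
  refine integral_congr_ae (Filter.Eventually.of_forall fun y => ?_)
  simp only
  rw [fourier_eq]
  ring

theorem integral_exp_mul_fourier (g : 𝓢(Vec b n, ℂ)) (x : Vec b n) :
    ∫ y, Complex.exp (-(Complex.I * (inner ℝ y x : ℝ))) * fourier g y = g x := by
  rw [integral_mul_fourier]
  have h : 𝓕⁻ (𝓕 (g : Vec b n → ℂ)) x = g x := by
    rw [g.continuous.fourierInv_fourier_eq g.integrable (𝓕 g).integrable]
  rw [← h, Real.fourierInv_eq']
  refine integral_congr_ae (Filter.Eventually.of_forall fun y => ?_)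
  simp only [smul_eq_mul]
  congr 2
  rw [inner_smul_left]
  simp only [map_neg, conj_trivial]
  push_cast
  ring

theorem continuous_fourier_schwartz (g : 𝓢(Vec b n, ℂ)) : Continuous (fourier (g : Vec b n → ℂ)) := by
  rw [funext (fourier_eq (g : Vec b n → ℂ))]
  exact continuous_const.mul ((𝓕 g).continuous.comp (continuous_const_smul _))

theorem integrable_fourier_schwartz (g : 𝓢(Vec b n, ℂ)) :
    Integrable (fourier (g : Vec b n → ℂ)) := by
  rw [funext (fourier_eq (g : Vec b n → ℂ))]
  refine Integrable.const_mul ?_ _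
  exact (𝓕 g).integrable.comp_smul (neg_ne_zero.2 (inv_ne_zero (by positivity)))

/-- The smooth extension of `z ↦ Ψ_ν(√z)` from `[0, ∞)` by a function that vanishes near `-∞`. -/
def besselExtension (ν z : ℝ) : ℝ := Real.smoothTransition (z + 1) * besselEntire ν z

theorem besselExtension_of_nonneg {ν z : ℝ} (hν : 0 ≤ ν) (hz : 0 ≤ z) :
    besselExtension ν z = besselPsi ν √z := by
  rw [besselExtension, Real.smoothTransition.one_of_one_le (by linarith), one_mul,
    besselPsi_eq hν (Real.sqrt_nonneg z), Real.sq_sqrt hz]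

variable {ν : ℝ} (hν : 0 ≤ ν)
  (hbdd : ∀ r : ℕ, ∃ C, ∀ z, 0 ≤ z → |besselEntire (ν + r) z| ≤ C)

include hν hbdd

/-- The `r`-th derivative is a constant times the function at `ν + r`, so `hbdd` bounds every
derivative on `[0, ∞)`. -/
theorem hasTemperateGrowth_besselExtension : (besselExtension ν).HasTemperateGrowth := by
  refine hasTemperateGrowth_smoothTransition_mul (contDiff_besselEntire hν _) fun r => ?_
  obtain ⟨c, hc⟩ := exists_iteratedDeriv_besselEntire r hν
  obtain ⟨C, hC⟩ := hbdd r
  refine ⟨|c| * C, fun z hz => ?_⟩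
  rw [hc, abs_mul]
  exact mul_le_mul_of_nonneg_left (hC z hz) (abs_nonneg c)

theorem integrable_besselMultiplier {j : ℕ} {u : Fin j → Vec b n} (hu : u ∈ nonnegDomain b n j)
    (g : 𝓢(Vec b n, ℂ)) : Integrable (besselMultiplier ν u g) := by
  have h0 : besselMultiplier ν u g =
      fun y => ((besselExtension ν (symbol u y) : ℝ) : ℂ) * fourier g y := by
    funext y
    rw [besselMultiplier, besselExtension_of_nonneg hν (hu y)]
  rw [h0]
  obtain ⟨C, hC⟩ := hbdd 0
  have hsc : Continuous fun y => symbol u y := continuous_symbol u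
  refine (integrable_fourier_schwartz g).bdd_mul (c := C) ?_
    (Filter.Eventually.of_forall fun y => ?_)
  · have hc := (hasTemperateGrowth_besselExtension hν hbdd).1.continuous
    exact (Complex.continuous_ofReal.comp (hc.comp hsc)).aestronglyMeasurable
  · rw [Complex.norm_real, Real.norm_eq_abs, besselExtension,
      Real.smoothTransition.one_of_one_le (by linarith [hu y]), one_mul]
    simpa using hC _ (hu y)

/-- Replacing `Ψ_ν(√z)` by `besselExtension` changes nothing on the domain, where the symbol is
nonnegative, and yields an integral smooth in every `u`. -/
theorem exists_schwartz_eqOn_besselOperator {j : ℕ} (f : 𝓢(Fin (j + 1) → Vec b n, ℂ)) :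
    ∃ g : 𝓢(Fin j → Vec b n, ℂ),
      Set.EqOn g (fun u => besselOperator ν u (lastSlice f u) 0) (nonnegDomain b n j) := by
  -- The factor `-2π` matches the substitution in `integral_mul_fourier`.
  set L : (Fin j → Vec b n) × Vec b n →L[ℝ] (Fin j → Vec b n) × Vec b n :=
    (ContinuousLinearMap.fst ℝ _ _).prod (-(2 * Real.pi) • ContinuousLinearMap.snd ℝ _ _) with hL
  set K : (Fin j → Vec b n) × Vec b n → ℂ →L[ℝ] ℂ := fun z =>
    besselExtension ν (symbol (L z).1 (L z).2) • ContinuousLinearMap.id ℝ ℂ with hK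
  have hKt : K.HasTemperateGrowth :=
    Function.HasTemperateGrowth.smul ((hasTemperateGrowth_besselExtension hν hbdd).comp
      ((hasTemperateGrowth_symbol j).comp L.hasTemperateGrowth))
      (Function.HasTemperateGrowth.const _)
  have hG : ContDiff ℝ ∞ fun u => ∫ y, K (u, y) (𝓕 (slice (uncurryLast f) u) y) :=
    contDiff_infty.2 fun m => contDiff_integral_fourier_slice m hKt _
  -- The bump equals `1` on the closed unit ball, which contains the domain.
  let χ : ContDiffBump (0 : Fin j → Vec b n) := ⟨1, 2, one_pos, one_lt_two⟩
  have hs : HasCompactSupport fun u =>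
      (χ u) • ∫ y, K (u, y) (𝓕 (slice (uncurryLast f) u) y) := χ.hasCompactSupport.smul_right
  refine ⟨hs.toSchwartzMap (χ.contDiff.smul hG), fun u hu => ?_⟩
  have h1 : χ u = 1 := χ.one_of_mem_closedBall
    (mem_closedBall_zero_iff.2 (norm_le_one_of_mem_nonnegDomain hu))
  change χ u • (∫ y, K (u, y) (𝓕 (slice (uncurryLast f) u) y)) = _
  rw [h1, one_smul]
  simp only [besselOperator, besselMultiplier, inner_zero_right, Complex.ofReal_zero, mul_zero,
    neg_zero, Complex.exp_zero, one_mul, lastSlice_eq_slice]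
  rw [integral_mul_fourier (fun y => ((besselPsi ν √(symbol u y) : ℝ) : ℂ))]
  refine integral_congr_ae (Filter.Eventually.of_forall fun y => ?_)
  simp only [hK, hL, ContinuousLinearMap.prod_apply, ContinuousLinearMap.coe_fst',
    ContinuousLinearMap.coe_snd', _root_.smul_apply, ContinuousLinearMap.coe_id', id_eq]
  rw [besselExtension_of_nonneg hν (hu _), Complex.real_smul]
  rfl

end Multiplier

/-! ### Haar probability on a compact group. -/

section Haar

variable (G : Type*) [Group G] [TopologicalSpace G] [IsTopologicalGroup G] [CompactSpace G]
  [MeasurableSpace G] [BorelSpace G]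

/-- The Haar probability measure of a compact group. -/
abbrev haarProb : Measure G := Measure.haarMeasure (⊤ : TopologicalSpace.PositiveCompacts G)

instance isProbabilityMeasure_haarProb : IsProbabilityMeasure (haarProb G) :=
  ⟨by simpa using Measure.haarMeasure_self (K₀ := (⊤ : TopologicalSpace.PositiveCompacts G))⟩

theorem haarAverage_eq (φ : G → ℂ) : haarAverage G φ = ∫ g, φ g ∂haarProb G := by
  have h : ‹MeasurableSpace G› = borel G := BorelSpace.measurable_eq
  subst h
  rfl

variable {G}

/-- Compact groups are unimodular: the image under a right translation is again a left-invariant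
probability measure, hence equal by uniqueness. -/
theorem integral_haarProb_mul_right {E : Type*} [NormedAddCommGroup E] [NormedSpace ℝ E]
    (φ : G → E) (h : G) : ∫ g, φ (g * h) ∂haarProb G = ∫ g, φ g ∂haarProb G := by
  have h1 : (haarProb G).map (Homeomorph.mulRight h).toMeasurableEquiv = haarProb G := by
    have hp : IsProbabilityMeasure ((haarProb G).map (· * h)) :=
      Measure.isProbabilityMeasure_map (measurable_mul_const h).aemeasurable
    exact Measure.isHaarMeasure_eq_of_isProbabilityMeasure ((haarProb G).map (· * h)) (haarProb G)
  conv_rhs => rw [← h1, integral_map_equiv]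
  rfl

end Haar

/-! ### Frames, their stabilizers and the recursion over the number of vectors. -/

section FrameAction

variable {b : Dyson} {n k : ℕ}

/-- The standard basis vectors of `𝕂ⁿ`. -/
def stdVec (b : Dyson) (n : ℕ) (i : Fin n) : Vec b n := EuclideanSpace.single (0, i) 1

theorem stdVec_apply (i : Fin n) (p : Fin b.beta × Fin n) :
    stdVec b n i p = if p = (0, i) then 1 else 0 := by
  simp [stdVec]

theorem norm_stdVec (i : Fin n) : ‖stdVec b n i‖ = 1 := by simp [stdVec]

/-- The coordinates of `𝕂ⁿ` orthogonal to the first `j` standard basis vectors. -/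
def tailCoords (b : Dyson) (n j : ℕ) : Finset (Fin b.beta × Fin n) :=
  Finset.univ.filter fun p => j ≤ p.2.val

theorem mem_tailCoords {j : ℕ} {p : Fin b.beta × Fin n} :
    p ∈ tailCoords b n j ↔ j ≤ p.2.val := by simp [tailCoords]

theorem sum_add_sum_tailCoords {M : Type*} [AddCommMonoid M] {j : ℕ} (hj : j ≤ n)
    (F : Fin b.beta × Fin n → M) :
    (∑ i : Fin j, ∑ l, F (l, Fin.castLE hj i)) + ∑ p ∈ tailCoords b n j, F p = ∑ p, F p := by
  rw [← Finset.sum_filter_not_add_sum_filter Finset.univ (fun p => j ≤ p.2.val) F]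
  congr 1
  rw [← Fintype.sum_prod_type']
  refine Finset.sum_bij (fun (q : Fin j × Fin b.beta) _ => (q.2, Fin.castLE hj q.1)) ?_ ?_ ?_ ?_
  · intro q _; simp
  · rintro ⟨i, l⟩ _ ⟨i', l'⟩ _ h
    simp only [Prod.mk.injEq, Fin.ext_iff, Fin.val_castLE] at h ⊢
    exact ⟨h.2, h.1⟩
  · rintro ⟨l, i⟩ hp
    simp only [Finset.mem_filter, not_le] at hp
    exact ⟨(⟨i, hp.2⟩, l), Finset.mem_univ _, rfl⟩
  · intro q _; rfl

theorem card_tailCoords {j : ℕ} (hj : j ≤ n) : (tailCoords b n j).card = b.beta * (n - j) := by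
  have h := sum_add_sum_tailCoords (b := b) hj fun _ => 1
  simp only [Finset.sum_const, Finset.card_univ, Fintype.card_fin, Fintype.card_prod, smul_eq_mul,
    mul_one] at h
  rw [Nat.mul_sub, Nat.mul_comm b.beta j]
  omega

/-- The Bessel index is the one belonging to the unit sphere in the tail coordinates. -/
theorem order_succ_eq {j : ℕ} (hj : j ≤ n) :
    order b n (j + 1) = ((tailCoords b n j).card : ℝ) / 2 - 1 := by
  rw [order, card_tailCoords hj]
  push_cast [Nat.cast_sub hj]
  ring

/-- The first row of the pattern of `J^{(l)}` is the `l`-th unit vector. Thus the `β` forms attached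
to a basis vector read off all real components of one 𝕂-coordinate. -/
theorem inner_stdVec_jMap (i : Fin n) (l : Fin b.beta) (y : Vec b n) :
    inner ℝ (stdVec b n i) (jMap b n l y) = y (l, i) := by
  rw [stdVec, EuclideanSpace.inner_single_left, map_one, one_mul, jMap_apply]
  have h : ∀ l a : Fin b.beta, jBlock b l 0 a = if a = l then 1 else 0 := by
    cases b
    · intro l a; fin_cases l; fin_cases a; rfl
    · intro l a; fin_cases l <;> fin_cases a <;> simp [jBlock, Dyson.beta] <;> rfl
    · intro l a; fin_cases l <;> fin_cases a <;> simp [jBlock, Dyson.beta] <;> rfl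
  simp [h]

/-- An action of a group on `𝕂ⁿ` by isometries commuting with the `J^{(l)}`, for which the pointwise
stabilizer of fewer than `k` standard basis vectors is transitive on the unit vectors orthogonal to
them. -/
structure FrameAction (b : Dyson) (n k : ℕ) (G : Type) [Group G] [TopologicalSpace G] where
  toHom : G →* Module.End ℝ (Vec b n)
  norm_map : ∀ g v, ‖toHom g v‖ = ‖v‖
  continuous_apply : ∀ v, Continuous fun g => toHom g v
  map_jMap : ∀ g l v, toHom g (jMap b n l v) = jMap b n l (toHom g v)
  transitive : ∀ j < k, ∀ v w : Vec b n, ‖v‖ = 1 → ‖w‖ = 1 → (∀ p ∉ tailCoords b n j, v p = 0) →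
    (∀ p ∉ tailCoords b n j, w p = 0) →
    ∃ h, (∀ i : Fin n, i.val < j → toHom h (stdVec b n i) = stdVec b n i) ∧ toHom h v = w

namespace FrameAction

variable {G : Type} [Group G] [TopologicalSpace G] (ρ : FrameAction b n k G)

theorem inner_map_map (g : G) (v w : Vec b n) :
    inner ℝ (ρ.toHom g v) (ρ.toHom g w) = inner ℝ v w :=
  (⟨ρ.toHom g, ρ.norm_map g⟩ : Vec b n →ₗᵢ[ℝ] Vec b n).inner_map_map v w

theorem map_mul_apply (g h : G) (v : Vec b n) :
    ρ.toHom (g * h) v = ρ.toHom g (ρ.toHom h v) := by rw [map_mul]; rfl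

theorem map_inv_map (g : G) (v : Vec b n) : ρ.toHom g⁻¹ (ρ.toHom g v) = v := by
  rw [← map_mul_apply, inv_mul_cancel, map_one]; rfl

theorem map_map_inv (g : G) (v : Vec b n) : ρ.toHom g (ρ.toHom g⁻¹ v) = v := by
  rw [← map_mul_apply, mul_inv_cancel, map_one]; rfl

theorem inner_map_left (g : G) (v w : Vec b n) :
    inner ℝ (ρ.toHom g v) w = inner ℝ v (ρ.toHom g⁻¹ w) := by
  rw [← ρ.inner_map_map g v, map_map_inv]

/-- The frame of the images of the first `j` standard basis vectors. -/
def frame {j : ℕ} (hj : j ≤ n) (g : G) : Fin j → Vec b n :=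
  fun i => ρ.toHom g (stdVec b n (Fin.castLE hj i))

theorem continuous_frame {j : ℕ} (hj : j ≤ n) : Continuous (ρ.frame hj) :=
  continuous_pi fun _ => ρ.continuous_apply _

/-- Moving `g` to the other side, which is allowed since it is isometric and commutes with the
`J^{(l)}`, reduces to the standard frame, whose forms subtract exactly the first `j` 𝕂-coordinates.
-/
theorem symbol_frame {j : ℕ} (hj : j ≤ n) (g : G) (y : Vec b n) :
    symbol (ρ.frame hj g) y = ∑ p ∈ tailCoords b n j, ρ.toHom g⁻¹ y p ^ 2 := by
  rw [symbol_eq, ← ρ.norm_map g⁻¹ y, EuclideanSpace.real_norm_sq_eq,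
    ← sum_add_sum_tailCoords hj fun p => ρ.toHom g⁻¹ y p ^ 2]
  simp only [frame, inner_map_left, ρ.map_jMap, inner_stdVec_jMap]
  ring

theorem frame_mem_nonnegDomain {j : ℕ} (hj : j ≤ n) (g : G) :
    ρ.frame hj g ∈ nonnegDomain b n j := fun y => by
  rw [symbol_frame]
  exact Finset.sum_nonneg fun p _ => sq_nonneg _

/-- The pointwise stabilizer of the first `j` standard basis vectors. -/
def stabilizer (j : ℕ) : Subgroup G where
  carrier := {h | ∀ i : Fin n, i.val < j → ρ.toHom h (stdVec b n i) = stdVec b n i}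
  mul_mem' {g h} hg hh i hi := by rw [map_mul_apply, hh i hi, hg i hi]
  one_mem' i _ := by rw [map_one]; rfl
  inv_mem' {g} hg i hi := by
    conv_lhs => rw [← hg i hi]
    rw [map_inv_map]

theorem isClosed_stabilizer (j : ℕ) : IsClosed (ρ.stabilizer j : Set G) := by
  have h : (ρ.stabilizer j : Set G) =
      ⋂ i : Fin n, ⋂ _ : i.val < j, {h | ρ.toHom h (stdVec b n i) = stdVec b n i} := by
    ext g
    simp [stabilizer]
  rw [h]
  exact isClosed_iInter fun i => isClosed_iInter fun _ =>
    isClosed_eq (ρ.continuous_apply _) continuous_const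

/-- An isometry that commutes with the `J^{(l)}` and fixes a basis vector preserves every real
component of that 𝕂-coordinate. -/
theorem map_stdVec_apply_eq_zero {j : ℕ} {h : G} (hh : h ∈ ρ.stabilizer j) {i : Fin n}
    (hi : j ≤ i.val) {p : Fin b.beta × Fin n} (hp : p ∉ tailCoords b n j) :
    ρ.toHom h (stdVec b n i) p = 0 := by
  obtain ⟨l, i'⟩ := p
  simp only [mem_tailCoords, not_le] at hp
  have h1 : ρ.toHom h⁻¹ (stdVec b n i') = stdVec b n i' := (ρ.stabilizer j).inv_mem hh i' hp
  rw [← inner_stdVec_jMap, ← ρ.map_jMap, real_inner_comm, ρ.inner_map_left, h1, real_inner_comm,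
    inner_stdVec_jMap, stdVec_apply, if_neg]
  intro h2
  rw [Prod.mk.injEq] at h2
  omega

theorem frame_mul {j : ℕ} (hj : j + 1 ≤ n) (g : G) {h : G} (hh : h ∈ ρ.stabilizer j) :
    ρ.frame hj (g * h) =
      Fin.snoc (α := fun _ => Vec b n) (ρ.frame (Nat.le_of_succ_le hj) g)
        (ρ.toHom (g * h) (stdVec b n ⟨j, hj⟩)) := by
  funext i
  refine Fin.lastCases ?_ (fun i => ?_) i
  · rw [Fin.snoc_last]; rfl
  · rw [Fin.snoc_castSucc]
    simp only [frame, map_mul_apply]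
    congr 1
    exact hh _ i.2

variable [IsTopologicalGroup G] [CompactSpace G]

instance compactSpace_stabilizer (j : ℕ) : CompactSpace (ρ.stabilizer j) :=
  isCompact_iff_compactSpace.mp (ρ.isClosed_stabilizer j).isCompact

variable [MeasurableSpace G] [BorelSpace G]

/-- The orbit map of the next basis vector pushes Haar measure to the uniform measure on the sphere
in the tail coordinates: left invariance and transitivity make its moments depend only on the norm.
-/
theorem integral_exp_stabilizer {j : ℕ} (hjk : j < k) (hjn : j < n)
    (h2 : 2 ≤ (tailCoords b n j).card) (y : Vec b n) :
    ∫ h, Complex.exp (-(Complex.I * (inner ℝ y (ρ.toHom (h : G) (stdVec b n ⟨j, hjn⟩)) : ℝ)))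
        ∂haarProb (ρ.stabilizer j) =
      (besselEntire ((tailCoords b n j).card / 2 - 1) (∑ p ∈ tailCoords b n j, y p ^ 2) : ℝ) := by
  have hcont : Continuous fun h : ρ.stabilizer j => ρ.toHom (h : G) (stdVec b n ⟨j, hjn⟩) :=
    (ρ.continuous_apply _).comp continuous_subtype_val
  refine integral_exp_inner_eq hcont.aestronglyMeasurable
    (fun h => by rw [ρ.norm_map, norm_stdVec])
    (fun h p hp => ρ.map_stdVec_apply_eq_zero h.2 le_rfl hp) ?_ h2 y
  intro v w hv hw hvS hwS m
  obtain ⟨h', hh', rfl⟩ := ρ.transitive j hjk v w hv hw hvS hwS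
  set H : ρ.stabilizer j := ⟨h', hh'⟩
  rw [← integral_mul_left_eq_self (fun h : ρ.stabilizer j => inner ℝ (ρ.toHom h' v)
    (ρ.toHom (h : G) (stdVec b n ⟨j, hjn⟩)) ^ m) H]
  refine integral_congr_ae (Filter.Eventually.of_forall fun h => ?_)
  simp only [Subgroup.coe_mul, H, map_mul_apply, inner_map_map]

include ρ in
-- The value at `z` is that of the characteristic function of a probability measure at a vector of
-- norm `√z`.
theorem abs_besselEntire_le_one {j : ℕ} (hjk : j < k) (hjn : j < n)
    (h2 : 2 ≤ (tailCoords b n j).card) {z : ℝ} (hz : 0 ≤ z) :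
    |besselEntire ((tailCoords b n j).card / 2 - 1) z| ≤ 1 := by
  have h := ρ.integral_exp_stabilizer hjk hjn h2 (√z • stdVec b n ⟨j, hjn⟩)
  have h1 : ∑ p ∈ tailCoords b n j, (√z • stdVec b n ⟨j, hjn⟩) p ^ 2 = z := by
    rw [Finset.sum_eq_single (0, ⟨j, hjn⟩)]
    · simp [stdVec_apply, Real.sq_sqrt hz]
    · intro p _ hp
      simp [stdVec_apply, hp]
    · intro h; exact absurd (mem_tailCoords.2 le_rfl) h
  rw [h1] at h
  rw [← Real.norm_eq_abs, ← Complex.norm_real, ← h]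
  refine (norm_integral_le_of_norm_le_const (C := 1) (Filter.Eventually.of_forall fun h => ?_)).trans
    (by simp)
  rw [Complex.norm_exp]
  simp

/-- `T_{n,j+1}` integrates over the sphere orthogonal to a frame. -/
theorem opT_frame {j : ℕ} (hjk : j < k) (hjn : j + 1 ≤ n) (h2 : 2 ≤ (tailCoords b n j).card)
    (f : 𝓢(Fin (j + 1) → Vec b n, ℂ)) (g : G) :
    opT f (ρ.frame (Nat.le_of_succ_le hjn) g) =
      ∫ h, f (ρ.frame hjn (g * (h : G))) ∂haarProb (ρ.stabilizer j) := by
  set u := ρ.frame (Nat.le_of_succ_le hjn) g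
  set s : 𝓢(Vec b n, ℂ) := slice (uncurryLast f) u
  have hcard : (2 : ℝ) ≤ (tailCoords b n j).card := by exact_mod_cast h2
  have hν : (0 : ℝ) ≤ (tailCoords b n j).card / 2 - 1 := by linarith
  have hkernel : ∀ y, ((besselPsi (order b n (j + 1)) √(symbol u y) : ℝ) : ℂ) =
      ∫ h, Complex.exp (-(Complex.I *
        (inner ℝ y (ρ.toHom (g * (h : G)) (stdVec b n ⟨j, hjn⟩)) : ℝ)))
        ∂haarProb (ρ.stabilizer j) := by
    intro y
    rw [order_succ_eq (Nat.le_of_succ_le hjn), besselPsi_eq hν (Real.sqrt_nonneg _),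
      Real.sq_sqrt (ρ.frame_mem_nonnegDomain _ g y), symbol_frame,
      ← ρ.integral_exp_stabilizer hjk hjn h2]
    refine integral_congr_ae (Filter.Eventually.of_forall fun h => ?_)
    simp only
    rw [map_mul_apply, ← ρ.inner_map_map g (ρ.toHom g⁻¹ y), map_map_inv]
  have hL : opT f u = ∫ y, ∫ h, Complex.exp (-(Complex.I *
        (inner ℝ y (ρ.toHom (g * (h : G)) (stdVec b n ⟨j, hjn⟩)) : ℝ))) * fourier s y
        ∂haarProb (ρ.stabilizer j) := by
    simp only [opT, besselOperator, besselMultiplier, inner_zero_right, Complex.ofReal_zero,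
      mul_zero, neg_zero, Complex.exp_zero, one_mul, lastSlice_eq_slice, hkernel]
    refine integral_congr_ae (Filter.Eventually.of_forall fun y => ?_)
    simp only
    rw [integral_mul_const]
  -- After the swap the integral over `y` is Fourier inversion at the point `g h e_j`. The swap is
  -- legitimate because the exponential has modulus one and the transform of `s` is integrable.
  rw [hL, integral_integral_swap]
  · refine integral_congr_ae (Filter.Eventually.of_forall fun h => ?_)
    simp only
    rw [integral_exp_mul_fourier s, ρ.frame_mul hjn g h.2]
    rfl
  · have hi : Integrable (fun z : Vec b n × ρ.stabilizer j => fourier s z.1 * (1 : ℂ))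
        (volume.prod (haarProb (ρ.stabilizer j))) :=
      (integrable_fourier_schwartz s).mul_prod (integrable_const _)
    refine hi.mono (Continuous.aestronglyMeasurable ?_) (Filter.Eventually.of_forall fun z => ?_)
    · have hc : Continuous fun z : Vec b n × ρ.stabilizer j =>
          ρ.toHom (g * (z.2 : G)) (stdVec b n ⟨j, hjn⟩) :=
        (ρ.continuous_apply _).comp (by fun_prop)
      have hf := (continuous_fourier_schwartz s).comp
        (continuous_fst : Continuous fun z : Vec b n × ρ.stabilizer j => z.1)
      exact (by fun_prop : Continuous fun z : Vec b n × ρ.stabilizer j => Complex.exp (-(Complex.I *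
        (inner ℝ z.1 (ρ.toHom (g * (z.2 : G)) (stdVec b n ⟨j, hjn⟩)) : ℝ)))).mul hf
    · simp [Function.uncurry, Complex.norm_exp]

theorem integral_opT_frame {j : ℕ} (hjk : j < k) (hjn : j + 1 ≤ n)
    (h2 : 2 ≤ (tailCoords b n j).card) (f : 𝓢(Fin (j + 1) → Vec b n, ℂ)) :
    ∫ g, opT f (ρ.frame (Nat.le_of_succ_le hjn) g) ∂haarProb G =
      ∫ g, f (ρ.frame hjn g) ∂haarProb G := by
  simp only [ρ.opT_frame hjk hjn h2]
  have hc : Continuous fun z : G × ρ.stabilizer j => f (ρ.frame hjn (z.1 * (z.2 : G))) :=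
    f.continuous.comp ((ρ.continuous_frame hjn).comp (by fun_prop))
  rw [integral_integral_swap_of_hasCompactSupport (f := fun g (h : ρ.stabilizer j) =>
    f (ρ.frame hjn (g * (h : G)))) hc (HasCompactSupport.of_compactSpace _)]
  simp only [integral_haarProb_mul_right (fun g => f (ρ.frame hjn g))]
  simp

/-- Each chosen Schwartz function agrees with `opT` on all frames, so every choice leads to the same
group integral. -/
theorem eq_integral_of_isIteratedT (h2 : ∀ j < k, 2 ≤ (tailCoords b n j).card) {j : ℕ}
    (hjk : j ≤ k) (hjn : j ≤ n) (f : 𝓢(Fin j → Vec b n, ℂ)) {c : ℂ} (h : IsIteratedT j f c) :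
    c = ∫ g, f (ρ.frame hjn g) ∂haarProb G := by
  induction j generalizing c with
  | zero =>
    have h0 : ∀ g, ρ.frame hjn g = 0 := fun g => Subsingleton.elim _ _
    simp only [h0, integral_const, probReal_univ, one_smul]
    exact h
  | succ j ih =>
    obtain ⟨φ, hφ, h⟩ := h
    rw [ih (Nat.le_of_succ_le hjk) (Nat.le_of_succ_le hjn) φ h,
      ← ρ.integral_opT_frame hjk hjn (h2 j hjk)]
    exact integral_congr_ae (Filter.Eventually.of_forall fun g =>
      hφ (ρ.frame_mem_nonnegDomain _ g))

end FrameAction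

end FrameAction

/-! ### Transitivity on unit vectors by generalized reflections. -/

section Reflections

open Matrix

variable {K : Type} {n : ℕ}

/-- The matrix `u s u†`. -/
def outer [Ring K] [StarRing K] (u : Fin n → K) (s : K) : Matrix (Fin n) (Fin n) K :=
  Matrix.of fun i j => u i * s * star (u j)

section Ring

variable [Ring K] [StarRing K] (u : Fin n → K)

theorem outer_mul_outer (s t : K) : outer u s * outer u t = outer u (s * (star u ⬝ᵥ u) * t) := by
  ext i j
  simp only [outer, Matrix.mul_apply, Matrix.of_apply, dotProduct, Finset.mul_sum, Finset.sum_mul,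
    Pi.star_apply, mul_assoc]

theorem star_outer (s : K) : star (outer u s) = outer u (star s) := by
  ext i j
  simp [outer, Matrix.star_apply, mul_assoc]

theorem outer_add (s t : K) : outer u (s + t) = outer u s + outer u t := by
  ext i j
  simp [outer, mul_add, add_mul]

theorem outer_mulVec (s : K) (y : Fin n → K) :
    outer u s *ᵥ y = fun i => u i * (s * (star u ⬝ᵥ y)) := by
  funext i
  simp only [outer, mulVec, dotProduct, Matrix.of_apply, Finset.mul_sum, Pi.star_apply, mul_assoc]

theorem one_sub_outer_mem_unitary {s : K} (h : star s * (star u ⬝ᵥ u) * s = star s + s)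
    (h' : s * (star u ⬝ᵥ u) * star s = star s + s) :
    1 - outer u s ∈ unitary (Matrix (Fin n) (Fin n) K) := by
  have key : ∀ t t' : K, t * (star u ⬝ᵥ u) * t' = t + t' →
      (1 - outer u t) * (1 - outer u t') = 1 := by
    intro t t' ht
    rw [sub_mul, mul_sub, mul_sub, outer_mul_outer, ht, outer_add]
    simp
  rw [Unitary.mem_iff, star_sub, star_one, star_outer]
  exact ⟨key _ _ h, key _ _ (by rw [h', add_comm])⟩

theorem one_sub_outer_mulVec (s : K) (y : Fin n → K) :
    (1 - outer u s) *ᵥ y = fun i => y i - u i * (s * (star u ⬝ᵥ y)) := by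
  rw [sub_mulVec, one_mulVec, outer_mulVec]
  rfl

theorem one_sub_outer_mulVec_of_orthogonal (s : K) {y : Fin n → K} (h : star u ⬝ᵥ y = 0) :
    (1 - outer u s) *ᵥ y = y := by
  rw [one_sub_outer_mulVec, h]
  simp

end Ring

/-- A unitary matrix that maps the unit vector `x` to the unit vector `y` and fixes everything
orthogonal to `x - y`. -/
theorem exists_unitary_mulVec_eq [DivisionRing K] [StarRing K]
    (hdef : ∀ u : Fin n → K, star u ⬝ᵥ u = 0 → u = 0) {x y : Fin n → K}
    (hx : star x ⬝ᵥ x = 1) (hy : star y ⬝ᵥ y = 1) :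
    ∃ A ∈ unitary (Matrix (Fin n) (Fin n) K), A *ᵥ x = y ∧
      ∀ z, star (x - y) ⬝ᵥ z = 0 → A *ᵥ z = z := by
  set u := x - y with hu
  set t := star u ⬝ᵥ x with ht
  -- This uses that `x` and `y` are both unit vectors. It is the condition for `1 - u t⁻¹ u†` to be
  -- unitary, and that matrix sends `x` to `x - u = y`.
  have htt : star u ⬝ᵥ u = star t + t := by
    have h1 : star t = star x ⬝ᵥ u := by rw [ht, star_dotProduct, star_star]
    rw [h1, ht, hu, star_sub]
    simp only [sub_dotProduct, dotProduct_sub, hx, hy]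
    abel
  by_cases h0 : t = 0
  · have hz : u = 0 := hdef u (by rw [htt, h0]; simp)
    refine ⟨1, one_mem _, ?_, fun z _ => one_mulVec z⟩
    rw [one_mulVec]
    exact sub_eq_zero.1 hz
  · have hs : star t ≠ 0 := star_ne_zero.2 h0
    refine ⟨1 - outer u t⁻¹, one_sub_outer_mem_unitary u ?_ ?_, ?_, fun z hz =>
      one_sub_outer_mulVec_of_orthogonal u _ hz⟩
    · rw [htt, star_inv₀, mul_add, add_mul, inv_mul_cancel₀ hs, mul_assoc, mul_inv_cancel₀ h0]
      simp [add_comm]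
    · rw [htt, star_inv₀, mul_add, add_mul, inv_mul_cancel₀ h0, mul_assoc, mul_inv_cancel₀ hs]
      simp [add_comm]
    · rw [one_sub_outer_mulVec, ← ht, inv_mul_cancel₀ h0]
      funext i
      simp [hu]

theorem det_one_sub_outer (u : Fin n → ℝ) (s : ℝ) :
    (1 - outer u s).det = 1 - s * (u ⬝ᵥ u) := by
  have h : 1 - outer u s = 1 + replicateCol Unit (-s • u) * replicateRow Unit u := by
    ext i j
    simp [outer, Matrix.mul_apply, sub_eq_add_neg, mul_comm (u i)]
  rw [h, det_one_add_replicateCol_mul_replicateRow]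
  simp [dotProduct_smul, sub_eq_add_neg]

/-- If the unitary matrix obtained has determinant `-1`, it is corrected by a reflection fixing `y`
and the first `j` basis vectors. Such a reflection is found in a coordinate plane, which needs `j +
1 < n`; this is where `k < n` enters for transitivity of `SO(n)`. -/
theorem exists_specialOrthogonal_mulVec_eq {j : ℕ} (hj : j + 1 < n) {x y : Fin n → ℝ}
    (hx : star x ⬝ᵥ x = 1) (hy : star y ⬝ᵥ y = 1) (hxj : ∀ i : Fin n, i.val < j → x i = 0)
    (hyj : ∀ i : Fin n, i.val < j → y i = 0) :
    ∃ A ∈ specialOrthogonalGroup (Fin n) ℝ, A *ᵥ x = y ∧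
      ∀ i : Fin n, i.val < j → A *ᵥ Pi.single i 1 = Pi.single i 1 := by
  obtain ⟨A, hA, hAx, hAz⟩ := exists_unitary_mulVec_eq
    (fun u hu => by simpa using (dotProduct_self_eq_zero.1 hu)) hx hy
  have hAi : ∀ i : Fin n, i.val < j → A *ᵥ Pi.single i 1 = Pi.single i 1 := fun i hi =>
    hAz _ (by simp [hxj i hi, hyj i hi])
  have hdet : A.det = 1 ∨ A.det = -1 := by
    have h1 : star A.det * A.det = 1 := by
      rw [← det_one (R := ℝ) (n := Fin n), ← (Unitary.mem_iff.1 hA).1, det_mul,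
        star_eq_conjTranspose, det_conjTranspose]
    exact mul_self_eq_one_iff.1 (by simpa using h1)
  rcases hdet with h1 | h1
  · exact ⟨A, mem_specialOrthogonalGroup_iff.2 ⟨hA, h1⟩, hAx, hAi⟩
  · set p : Fin n := ⟨j, by omega⟩ with hp
    set q : Fin n := ⟨j + 1, hj⟩ with hq
    have hpq : p ≠ q := by simp [hp, hq]
    -- A plane contains a nonzero vector orthogonal to `y`; the reflection is taken along it.
    obtain ⟨α, β, hne, hαβ⟩ : ∃ α β : ℝ, α ^ 2 + β ^ 2 ≠ 0 ∧ α * y p + β * y q = 0 := by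
      by_cases h : y p = 0
      · exact ⟨1, 0, by norm_num, by simp [h]⟩
      · refine ⟨y q, -y p, ?_, by ring⟩
        have := sq_pos_of_ne_zero h
        nlinarith [sq_nonneg (y q)]
    set z : Fin n → ℝ := Pi.single p α + Pi.single q β with hz
    have hzz : z ⬝ᵥ z = α ^ 2 + β ^ 2 := by
      simp [hz, dotProduct_add, hpq, hpq.symm]
      ring
    have hzy : star z ⬝ᵥ y = 0 := by
      simp only [star_trivial, hz, add_dotProduct, single_dotProduct]
      exact hαβ
    have hs : ∀ s : ℝ, s = 2 / (α ^ 2 + β ^ 2) → s * (star z ⬝ᵥ z) = 2 := by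
      rintro s rfl
      rw [star_trivial, hzz]
      field_simp
    set s := 2 / (α ^ 2 + β ^ 2) with hsdef
    have hR : 1 - outer z s ∈ unitary (Matrix (Fin n) (Fin n) ℝ) := by
      refine one_sub_outer_mem_unitary z ?_ ?_ <;>
      · rw [star_trivial s, hs s rfl]; ring
    refine ⟨(1 - outer z s) * A, mem_specialOrthogonalGroup_iff.2 ⟨mul_mem hR hA, ?_⟩, ?_, ?_⟩
    · have := hs s rfl
      rw [star_trivial] at this
      rw [det_mul, h1, det_one_sub_outer, this]
      norm_num
    · rw [← mulVec_mulVec, hAx, one_sub_outer_mulVec_of_orthogonal z s hzy]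
    · intro i hi
      rw [← mulVec_mulVec, hAi i hi, one_sub_outer_mulVec_of_orthogonal]
      have hip : i ≠ p := fun h => by simp [h, hp] at hi
      have hiq : i ≠ q := fun h => by simp [h, hq] at hi
      simp [hz, hip, hiq]

end Reflections

/-! ### Real coordinates on 𝕂 and the actions of the three groups. -/

section Coordinates

open Matrix

/-- Real coordinates on `𝕂` in which the components of `x̄ y` are the forms `⟨x, J^{(l)} y⟩`. -/
structure Coordinates (b : Dyson) (K : Type) [NormedDivisionRing K] [StarRing K]
    [NormedAlgebra ℝ K] where
  equiv : K ≃L[ℝ] (Fin b.beta → ℝ)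
  map_one : equiv 1 = Pi.single 0 1
  star_mul_self : ∀ x, star x * x = algebraMap ℝ K (∑ a, equiv x a ^ 2)
  map_star_mul : ∀ x y l,
    equiv (star x * y) l = ∑ a, equiv x a * ∑ c, jBlock b l a c * equiv y c

namespace Coordinates

variable {b : Dyson} {K : Type} [NormedDivisionRing K] [StarRing K] [NormedAlgebra ℝ K]
  (C : Coordinates b K) {n : ℕ}

/-- The identification `𝕂ⁿ ≅ ℝ^{βn}`. -/
def toVec (n : ℕ) : (Fin n → K) ≃ₗ[ℝ] Vec b n where
  toFun x := WithLp.toLp 2 fun p => C.equiv (x p.2) p.1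
  invFun v := fun i => C.equiv.symm fun a => v (a, i)
  left_inv x := by simp
  right_inv v := by ext p; simp
  map_add' x y := by ext p; simp
  map_smul' c x := by ext p; simp

theorem toVec_apply (x : Fin n → K) (p : Fin b.beta × Fin n) :
    C.toVec n x p = C.equiv (x p.2) p.1 := rfl

theorem toVec_single (i : Fin n) : C.toVec n (Pi.single i 1) = stdVec b n i := by
  ext p
  obtain ⟨a, i'⟩ := p
  rw [toVec_apply, stdVec_apply]
  by_cases h : i' = i
  · subst h
    simp [C.map_one, Pi.single_apply]
  · simp [h]

theorem inner_toVec_jMap (x y : Fin n → K) (l : Fin b.beta) :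
    inner ℝ (C.toVec n x) (jMap b n l (C.toVec n y)) = C.equiv (star x ⬝ᵥ y) l := by
  rw [PiLp.inner_apply, Fintype.sum_prod_type_right]
  simp only [dotProduct, map_sum, Finset.sum_apply, Pi.star_apply, C.map_star_mul]
  refine Finset.sum_congr rfl fun i _ => Finset.sum_congr rfl fun a _ => ?_
  rw [jMap_apply]
  simp only [toVec_apply, RCLike.inner_apply, conj_trivial, mul_comm]

theorem star_dotProduct_self (x : Fin n → K) :
    star x ⬝ᵥ x = algebraMap ℝ K (‖C.toVec n x‖ ^ 2) := by
  simp only [dotProduct, Pi.star_apply, C.star_mul_self]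
  rw [← map_sum, EuclideanSpace.real_norm_sq_eq, Fintype.sum_prod_type_right]
  rfl

include C in
theorem eq_zero_of_star_dotProduct_self (x : Fin n → K) (h : star x ⬝ᵥ x = 0) : x = 0 := by
  rw [C.star_dotProduct_self, map_eq_zero_iff _ (algebraMap ℝ K).injective,
    sq_eq_zero_iff, norm_eq_zero] at h
  exact (C.toVec n).map_eq_zero_iff.1 h

omit [NormedAlgebra ℝ K] in
theorem star_mulVec_dotProduct {A : Matrix (Fin n) (Fin n) K} (hA : A ∈ unitary (Matrix _ _ K))
    (x y : Fin n → K) : star (A *ᵥ x) ⬝ᵥ (A *ᵥ y) = star x ⬝ᵥ y := by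
  rw [star_mulVec, dotProduct_mulVec, vecMul_vecMul, ← star_eq_conjTranspose,
    (Unitary.mem_iff.1 hA).1, vecMul_one]

theorem continuous_toVec (n : ℕ) : Continuous (C.toVec n) :=
  (PiLp.continuous_toLp 2 _).comp (continuous_pi fun p =>
    (continuous_apply p.1).comp (C.equiv.continuous.comp (continuous_apply p.2)))

theorem inner_toVec (x y : Fin n → K) :
    inner ℝ (C.toVec n x) (C.toVec n y) = C.equiv (star x ⬝ᵥ y) 0 := by
  rw [← C.inner_toVec_jMap, jMap_zero]

/-- The real linear map on `ℝ^{βn}` given by a matrix over `𝕂`. -/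
def matrixHom (n : ℕ) : Matrix (Fin n) (Fin n) K →* Module.End ℝ (Vec b n) where
  toFun A :=
    { toFun := fun v => C.toVec n (A *ᵥ (C.toVec n).symm v)
      map_add' := fun v w => by rw [map_add, mulVec_add, map_add]
      map_smul' := fun c v => by rw [map_smul, mulVec_smul, map_smul, RingHom.id_apply] }
  map_one' := LinearMap.ext fun v =>
    (congrArg (C.toVec n) (one_mulVec _)).trans (LinearEquiv.apply_symm_apply _ v)
  map_mul' A B := LinearMap.ext fun v => by
    change C.toVec n ((A * B) *ᵥ _) =
      C.toVec n (A *ᵥ (C.toVec n).symm (C.toVec n (B *ᵥ (C.toVec n).symm v)))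
    rw [LinearEquiv.symm_apply_apply, mulVec_mulVec]

theorem matrixHom_toVec (A : Matrix (Fin n) (Fin n) K) (x : Fin n → K) :
    C.matrixHom n A (C.toVec n x) = C.toVec n (A *ᵥ x) := by
  change C.toVec n (A *ᵥ (C.toVec n).symm (C.toVec n x)) = _
  rw [LinearEquiv.symm_apply_apply]

theorem norm_matrixHom {A : Matrix (Fin n) (Fin n) K} (hA : A ∈ unitary (Matrix _ _ K))
    (v : Vec b n) : ‖C.matrixHom n A v‖ = ‖v‖ := by
  obtain ⟨x, rfl⟩ := (C.toVec n).surjective v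
  have h := star_mulVec_dotProduct hA x x
  rw [C.star_dotProduct_self, C.star_dotProduct_self] at h
  rw [matrixHom_toVec]
  exact (sq_eq_sq₀ (norm_nonneg _) (norm_nonneg _)).1 ((algebraMap ℝ K).injective h)

/-- The form `⟨y, J^{(l)} x⟩` is a component of `y† x`, which unitary matrices preserve. Testing
against vectors `A y`, which exhaust the space, gives commutation. -/
theorem matrixHom_jMap {A : Matrix (Fin n) (Fin n) K} (hA : A ∈ unitary (Matrix _ _ K))
    (l : Fin b.beta) (v : Vec b n) :
    C.matrixHom n A (jMap b n l v) = jMap b n l (C.matrixHom n A v) := by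
  obtain ⟨x, rfl⟩ := (C.toVec n).surjective v
  refine ext_inner_left ℝ fun w => ?_
  obtain ⟨y, rfl⟩ : ∃ y, C.toVec n (A *ᵥ y) = w := by
    refine ⟨star A *ᵥ (C.toVec n).symm w, ?_⟩
    rw [mulVec_mulVec, (Unitary.mem_iff.1 hA).2, one_mulVec, LinearEquiv.apply_symm_apply]
  obtain ⟨x', hx'⟩ := (C.toVec n).surjective (jMap b n l (C.toVec n x))
  rw [matrixHom_toVec, C.inner_toVec_jMap, star_mulVec_dotProduct hA, ← C.inner_toVec_jMap, ← hx',
    matrixHom_toVec, inner_toVec, star_mulVec_dotProduct hA, ← inner_toVec]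

theorem eq_zero_of_toVec_eq_zero {j : ℕ} {z : Fin n → K}
    (hz : ∀ p ∉ tailCoords b n j, C.toVec n z p = 0) (i : Fin n) (hi : i.val < j) : z i = 0 := by
  have h : C.equiv (z i) = 0 := funext fun a => hz (a, i) (by simpa [mem_tailCoords] using hi)
  exact C.equiv.map_eq_zero_iff.1 h

/-- The action of a group of unitary matrices on `𝕂ⁿ ≅ ℝ^{βn}`. -/
def frameAction {k : ℕ} {G : Type} [Group G] [TopologicalSpace G]
    (φ : G →* Matrix (Fin n) (Fin n) K) (hφ : ∀ g, φ g ∈ unitary (Matrix (Fin n) (Fin n) K))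
    (hc : Continuous φ)
    (htrans : ∀ j < k, ∀ x y : Fin n → K, star x ⬝ᵥ x = 1 → star y ⬝ᵥ y = 1 →
      (∀ i : Fin n, i.val < j → x i = 0) → (∀ i : Fin n, i.val < j → y i = 0) →
      ∃ g, φ g *ᵥ x = y ∧ ∀ i : Fin n, i.val < j → φ g *ᵥ Pi.single i 1 = Pi.single i 1) :
    FrameAction b n k G where
  toHom := (C.matrixHom n).comp φ
  norm_map g v := C.norm_matrixHom (hφ g) v
  continuous_apply v :=
    (C.continuous_toVec n).comp (hc.matrix_mulVec continuous_const)
  map_jMap g l v := C.matrixHom_jMap (hφ g) l v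
  transitive j hj v w hv hw hvj hwj := by
    obtain ⟨x, rfl⟩ := (C.toVec n).surjective v
    obtain ⟨y, rfl⟩ := (C.toVec n).surjective w
    obtain ⟨g, hg, hgi⟩ := htrans j hj x y (by rw [C.star_dotProduct_self, hv]; simp)
      (by rw [C.star_dotProduct_self, hw]; simp) (C.eq_zero_of_toVec_eq_zero hvj)
      (C.eq_zero_of_toVec_eq_zero hwj)
    refine ⟨g, fun i hi => ?_, ?_⟩
    · rw [MonoidHom.comp_apply, ← C.toVec_single, matrixHom_toVec, hgi i hi]
    · rw [MonoidHom.comp_apply, matrixHom_toVec, hg]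

theorem frameAction_frame {k : ℕ} {G : Type} [Group G] [TopologicalSpace G]
    (φ : G →* Matrix (Fin n) (Fin n) K) (hφ : ∀ g, φ g ∈ unitary (Matrix (Fin n) (Fin n) K))
    (hc : Continuous φ) (htrans) {j : ℕ} (hj : j ≤ n) (g : G) :
    (C.frameAction (k := k) φ hφ hc htrans).frame hj g =
      fun i => C.toVec n fun r => φ g r (Fin.castLE hj i) := by
  funext i
  change C.matrixHom n (φ g) (stdVec b n _) = _
  rw [← C.toVec_single, matrixHom_toVec, mulVec_single_one]
  rfl

/-- The action of the group of all unitary matrices. -/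
def unitaryFrameAction (n k : ℕ) :
    FrameAction b n k (unitary (Matrix (Fin n) (Fin n) K)) :=
  C.frameAction (Submonoid.subtype _) (fun g => g.2) continuous_subtype_val
    fun j _ x y hx hy hxj hyj => by
      obtain ⟨A, hA, hAx, hAz⟩ :=
        exists_unitary_mulVec_eq C.eq_zero_of_star_dotProduct_self hx hy
      exact ⟨⟨A, hA⟩, hAx, fun i hi => hAz _ (by simp [hxj i hi, hyj i hi])⟩

end Coordinates

/-- The trivial coordinates on `ℝ`. -/
def realCoordinates : Coordinates .real ℝ where
  equiv := LinearEquiv.toContinuousLinearEquiv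
    { toFun := fun x => (![x] : Fin 1 → ℝ)
      invFun := fun v => v (0 : Fin 1)
      left_inv := fun x => rfl
      right_inv := fun v => by funext i; fin_cases i; rfl
      map_add' := fun x y => by funext i; fin_cases i; rfl
      map_smul' := fun c x => by funext i; fin_cases i; rfl }
  map_one := by funext i; fin_cases i; rfl
  star_mul_self x := by
    change _ = algebraMap ℝ ℝ (∑ a : Fin 1, (![x] : Fin 1 → ℝ) a ^ 2)
    simp [sq]
  map_star_mul x y l := by
    change (![star x * y] : Fin 1 → ℝ) l = ∑ a : Fin 1, (![x] : Fin 1 → ℝ) a *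
      ∑ c : Fin 1, (!![1] : Matrix (Fin 1) (Fin 1) ℝ) a c * (![y] : Fin 1 → ℝ) c
    fin_cases l
    simp

/-- Real and imaginary part as coordinates on `ℂ`. -/
def complexCoordinates : Coordinates .complex ℂ where
  equiv := LinearEquiv.toContinuousLinearEquiv
    { toFun := fun x => (![x.re, x.im] : Fin 2 → ℝ)
      invFun := fun v => ⟨v (0 : Fin 2), v (1 : Fin 2)⟩
      left_inv := fun x => rfl
      right_inv := fun v => by funext i; fin_cases i <;> rfl
      map_add' := fun x y => by funext i; fin_cases i <;> rfl
      map_smul' := fun c x => by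
        funext i
        fin_cases i
        · exact Complex.smul_re c x
        · exact Complex.smul_im c x }
  map_one := by funext i; fin_cases i <;> rfl
  star_mul_self x := by
    change _ = algebraMap ℝ ℂ (∑ a : Fin 2, (![x.re, x.im] : Fin 2 → ℝ) a ^ 2)
    apply Complex.ext <;> simp [Fin.sum_univ_two, sq, mul_comm]
  map_star_mul x y l := by
    change (![(star x * y).re, (star x * y).im] : Fin 2 → ℝ) l =
      ∑ a : Fin 2, (![x.re, x.im] : Fin 2 → ℝ) a *
      ∑ c : Fin 2, (![1, !![0, 1; -1, 0]] : Fin 2 → Matrix (Fin 2) (Fin 2) ℝ) l a c *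
        (![y.re, y.im] : Fin 2 → ℝ) c
    revert l
    change ∀ l : Fin 2, _
    rw [Fin.forall_fin_two]
    constructor <;> simp [Fin.sum_univ_two]

/-- The components with respect to `1, i, j, k` as coordinates on `ℍ`. -/
def quaternionCoordinates : Coordinates .quaternion (Quaternion ℝ) where
  equiv := LinearEquiv.toContinuousLinearEquiv
    { toFun := fun x => (![x.re, x.imI, x.imJ, x.imK] : Fin 4 → ℝ)
      invFun := fun v => ⟨v (0 : Fin 4), v (1 : Fin 4), v (2 : Fin 4), v (3 : Fin 4)⟩
      left_inv := fun x => rfl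
      right_inv := fun v => by funext i; fin_cases i <;> rfl
      map_add' := fun x y => by funext i; fin_cases i <;> rfl
      map_smul' := fun c x => by funext i; fin_cases i <;> rfl }
  map_one := by funext i; fin_cases i <;> rfl
  star_mul_self x := by
    change _ = algebraMap ℝ (Quaternion ℝ)
      (∑ a : Fin 4, (![x.re, x.imI, x.imJ, x.imK] : Fin 4 → ℝ) a ^ 2)
    rw [Quaternion.star_mul_self, Quaternion.normSq_def', Fin.sum_univ_four]
    rfl
  map_star_mul x y l := by
    change (![(star x * y).re, (star x * y).imI, (star x * y).imJ, (star x * y).imK] :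
        Fin 4 → ℝ) l =
      ∑ a : Fin 4, (![x.re, x.imI, x.imJ, x.imK] : Fin 4 → ℝ) a *
      ∑ c : Fin 4, (![1,
        !![0, 1, 0, 0; -1, 0, 0, 0; 0, 0, 0, -1; 0, 0, 1, 0],
        !![0, 0, 1, 0; 0, 0, 0, 1; -1, 0, 0, 0; 0, -1, 0, 0],
        !![0, 0, 0, 1; 0, 0, -1, 0; 0, 1, 0, 0; -1, 0, 0, 0]] :
        Fin 4 → Matrix (Fin 4) (Fin 4) ℝ) l a c *
        (![y.re, y.imI, y.imJ, y.imK] : Fin 4 → ℝ) c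
    revert l
    change ∀ l : Fin 4, _
    simp only [Fin.forall_fin_succ, Fin.sum_univ_four]
    refine ⟨?_, ?_, ?_, ?_, fun i => i.elim0⟩ <;>
      simp

/-- The action of `SO(n)`. -/
def specialOrthogonalFrameAction {n k : ℕ} (hk : k < n) :
    FrameAction .real n k (Matrix.specialOrthogonalGroup (Fin n) ℝ) :=
  realCoordinates.frameAction (Submonoid.subtype _)
    (fun g => (Matrix.mem_specialOrthogonalGroup_iff.1 g.2).1) continuous_subtype_val
    fun j hj x y hx hy hxj hyj => by
      obtain ⟨A, hA, hAx, hAi⟩ :=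
        exists_specialOrthogonal_mulVec_eq (by omega : j + 1 < n) hx hy hxj hyj
      exact ⟨⟨A, hA⟩, hAx, hAi⟩

end Coordinates

/-! ### Bounds in all dimensions and assembly of the theorem. -/

/-- Here `SO(d)` acts on the whole sphere of `ℝ^d`, with empty initial frame; the dimension `d` is
unrelated to the given `n`. -/
theorem abs_besselEntire_half_sub_one_le_one {d : ℕ} (hd : 2 ≤ d) {z : ℝ} (hz : 0 ≤ z) :
    |besselEntire ((d : ℝ) / 2 - 1) z| ≤ 1 := by
  let _ : MeasurableSpace (Matrix.specialOrthogonalGroup (Fin d) ℝ) := borel _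
  have : BorelSpace (Matrix.specialOrthogonalGroup (Fin d) ℝ) := ⟨rfl⟩
  have hcard : (tailCoords .real d 0).card = d := by
    rw [card_tailCoords (Nat.zero_le d)]
    exact Nat.one_mul d
  have h := (specialOrthogonalFrameAction (n := d) (k := 1) (by omega)).abs_besselEntire_le_one
    one_pos (by omega) (hcard.symm ▸ hd) hz
  rwa [hcard] at h

/-- This keeps the Bessel index nonnegative. For `β = 1` and `k = n` the last step would have
dimension one and index `-1/2`. -/
theorem two_le_card_tailCoords {b : Dyson} {n k : ℕ} (hkn : k ≤ n) (hreal : b = .real → k < n)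
    {j : ℕ} (hj : j < k) : 2 ≤ (tailCoords b n j).card := by
  rw [card_tailCoords (by omega)]
  cases b with
  | real =>
    have := hreal rfl
    change 2 ≤ 1 * (n - j)
    omega
  | complex => change 2 ≤ 2 * (n - j); omega
  | quaternion => change 2 ≤ 4 * (n - j); omega

theorem order_nonneg {b : Dyson} {n j : ℕ} (hj : j ≤ n) (h2 : 2 ≤ (tailCoords b n j).card) :
    0 ≤ order b n (j + 1) := by
  have h : (2 : ℝ) ≤ (tailCoords b n j).card := by exact_mod_cast h2
  rw [order_succ_eq hj]
  linarith

/-- Raising the index by `r` amounts to raising the dimension of the space by `2r`. -/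
theorem exists_abs_besselEntire_order_le {b : Dyson} {n j : ℕ} (hj : j ≤ n)
    (h2 : 2 ≤ (tailCoords b n j).card) (r : ℕ) :
    ∃ C, ∀ z, 0 ≤ z → |besselEntire (order b n (j + 1) + r) z| ≤ C := by
  refine ⟨1, fun z hz => ?_⟩
  have h : order b n (j + 1) + r = (((tailCoords b n j).card + 2 * r : ℕ) : ℝ) / 2 - 1 := by
    rw [order_succ_eq hj]
    push_cast
    ring
  rw [h]
  exact abs_besselEntire_half_sub_one_le_one (by omega) hz

theorem exists_isIteratedT {b : Dyson} {n k : ℕ}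
    (h : ∀ j < k, ∀ f : 𝓢(Fin (j + 1) → Vec b n, ℂ), ∃ g : 𝓢(Fin j → Vec b n, ℂ),
      Set.EqOn g (opT f) (nonnegDomain b n j)) {j : ℕ} (hj : j ≤ k)
    (f : 𝓢(Fin j → Vec b n, ℂ)) : ∃ c, IsIteratedT j f c := by
  induction j with
  | zero => exact ⟨f 0, rfl⟩
  | succ j ih =>
    obtain ⟨g, hg⟩ := h j hj f
    obtain ⟨c, hc⟩ := ih (Nat.le_of_succ_le hj) g
    exact ⟨c, g, hg, hc⟩

theorem eq_stiefelIntegral_of_isIteratedT {b : Dyson} {n k : ℕ} (hkn : k ≤ n)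
    (hreal : b = .real → k < n) (f : 𝓢(Fin k → Vec b n, ℂ)) {c : ℂ} (h : IsIteratedT k f c) :
    c = stiefelIntegral b hkn f := by
  have h2 : ∀ j < k, 2 ≤ (tailCoords b n j).card := fun _ hj =>
    two_le_card_tailCoords hkn hreal hj
  cases b with
  | real =>
    let _ : MeasurableSpace (Matrix.specialOrthogonalGroup (Fin n) ℝ) := borel _
    have : BorelSpace (Matrix.specialOrthogonalGroup (Fin n) ℝ) := ⟨rfl⟩
    rw [(specialOrthogonalFrameAction (hreal rfl)).eq_integral_of_isIteratedT h2 le_rfl hkn f h,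
      stiefelIntegral, haarAverage_eq]
    refine integral_congr_ae (Filter.Eventually.of_forall fun A => congrArg f
      ((realCoordinates.frameAction_frame _ _ _ _ hkn A).trans ?_))
    funext i
    ext ⟨a, r⟩
    change Fin 1 at a
    fin_cases a
    rfl
  | complex =>
    let _ : MeasurableSpace (Matrix.unitaryGroup (Fin n) ℂ) := borel _
    have : BorelSpace (Matrix.unitaryGroup (Fin n) ℂ) := ⟨rfl⟩
    rw [(complexCoordinates.unitaryFrameAction n k).eq_integral_of_isIteratedT h2 le_rfl hkn f h,
      stiefelIntegral, haarAverage_eq]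
    exact integral_congr_ae (Filter.Eventually.of_forall fun A => congrArg f
      (complexCoordinates.frameAction_frame _ _ _ _ hkn A))
  | quaternion =>
    let _ : MeasurableSpace (quaternionUnitaryGroup n) := borel _
    have : BorelSpace (quaternionUnitaryGroup n) := ⟨rfl⟩
    rw [(quaternionCoordinates.unitaryFrameAction n k).eq_integral_of_isIteratedT h2 le_rfl hkn f h,
      stiefelIntegral, haarAverage_eq]
    exact integral_congr_ae (Filter.Eventually.of_forall fun A => congrArg f
      (quaternionCoordinates.frameAction_frame _ _ _ _ hkn A))

end

end StiefelPizzetti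

theorem theorem6p2 (b : StiefelPizzetti.Dyson) (n k : ℕ) (hk : 1 ≤ k) (hkn : k ≤ n)
    (hreal : b = StiefelPizzetti.Dyson.real → k < n) :
    (∀ j < k, ∀ f : SchwartzMap (Fin (j + 1) → StiefelPizzetti.Vec b n) ℂ,
      (∀ u ∈ StiefelPizzetti.nonnegDomain b n j,
        MeasureTheory.Integrable (StiefelPizzetti.besselMultiplier
          (StiefelPizzetti.order b n (j + 1)) u (StiefelPizzetti.lastSlice f u))) ∧
      ∃ g : SchwartzMap (Fin j → StiefelPizzetti.Vec b n) ℂ,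
        Set.EqOn g (StiefelPizzetti.opT f) (StiefelPizzetti.nonnegDomain b n j)) ∧
    ∀ (f : SchwartzMap (Fin k → StiefelPizzetti.Vec b n) ℂ) (c : ℂ),
      StiefelPizzetti.IsIteratedT k f c ↔ c = StiefelPizzetti.stiefelIntegral b hkn f := by
  open StiefelPizzetti in
  have h1 : ∀ j < k, ∀ f : SchwartzMap (Fin (j + 1) → Vec b n) ℂ,
      (∀ u ∈ nonnegDomain b n j,
        MeasureTheory.Integrable (besselMultiplier (order b n (j + 1)) u (lastSlice f u))) ∧
      ∃ g : SchwartzMap (Fin j → Vec b n) ℂ, Set.EqOn g (opT f) (nonnegDomain b n j) := by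
    intro j hj f
    have hjn : j ≤ n := by omega
    have h2 := two_le_card_tailCoords hkn hreal hj
    have hν := order_nonneg hjn h2
    have hbdd := exists_abs_besselEntire_order_le hjn h2
    refine ⟨fun u hu => ?_, exists_schwartz_eqOn_besselOperator hν hbdd f⟩
    rw [lastSlice_eq_slice]
    exact integrable_besselMultiplier hν hbdd hu _
  refine ⟨h1, fun f c => ⟨StiefelPizzetti.eq_stiefelIntegral_of_isIteratedT hkn hreal f, ?_⟩⟩
  rintro rfl
  -- Some value is attained because extensions exist; the forward direction identifies it with the
  -- Stiefel integral.
  obtain ⟨c, hc⟩ := StiefelPizzetti.exists_isIteratedT (fun j hj f => (h1 j hj f).2) le_rfl f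
  rwa [← StiefelPizzetti.eq_stiefelIntegral_of_isIteratedT hkn hreal f hc]
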